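/- Let $\mathbf T$ be the unit circle in $\mathbb C$ and let $\alpha$ be its normalized Haar measure. For $f:\mathbf T\to\mathbb R$ put $f'(z)=\frac{d}{dt}\big|_{t=0}f(ze^{it})$. For a continuous $Q:\mathbf T\to\mathbb R$ and a Borel probability measure $\mu$ on $\mathbf T$ let $$E_Q(\mu)=\int Q\,d\mu-\iint\log|z-w|\,\mu(dz)\,\mu(dw)\in(-\infty,+\infty],$$ and let $\mu_Q$ denote the equilibrium measure of $Q$, that is, the minimizer of $E_Q$ over all Borel probability measures on $\mathbf T$. Call a probability measure $\mu$ smooth if $\mu=f\,\alpha$ with a nonnegative $C^1$ density $f$ (in particular, every $C^\infty$ density is allowed). The circular Hilbert transform of $\mu$ is $$H\mu(z)=\mathrm{p.v.}\int_{\mathbf T} i\,\frac{z+w}{z-w}\,\mu(dw),\qquad\text{i.e.}\qquad H\mu(e^{ix})=\mathrm{p.v.}\int\cot\Big(\frac{x-y}{2}\Big)\,\mu(d e^{iy}),$$ and the free Fisher information is $$I_Q(\mu)=\int (H\mu-Q')^2\,d\mu-\Big(\int Q'\,d\mu\Big)^2 .$$ Theorem. Let $\rho>0$ and let $Q:\mathbf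 T\to\mathbb R$ be of class $C^3$ with $Q''\ge\rho-\frac12$ on $\mathbf T$. Then $Q$ satisfies the free log-Sobolev inequality $LSI(\rho/2)$: an equilibrium measure $\mu_Q$ exists and has finite energy, and every smooth probability measure $\mu$ on $\mathbf T$ has finite energy $E_Q(\mu)$, its Hilbert transform $H\mu$ exists at every point of $\mathbf T$ with $(H\mu-Q')^2$ being $\mu$-integrable, and $$E_Q(\mu)-E_Q(\mu_Q)\le\frac{1}{2\rho}\,I_Q(\mu).$$ -/

import Mathlib

open scoped Manifold ContDiff ENNReal Topology
open MeasureTheory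

noncomputable instance Circle.instMeasurableSpaceBorel : MeasurableSpace Circle := borel Circle

instance Circle.instBorelSpaceBorel : BorelSpace Circle := ⟨rfl⟩

/-- The normalized Haar (uniform) measure `α` on the unit circle:
`∫ f dα = (1 / 2π) ∫_{-π}^{π} f (e^{ix}) dx`. -/
noncomputable def circleHaar : Measure Circle :=
  ENNReal.ofReal (1 / (2 * Real.pi)) •
    (volume.restrict (Set.Ioc (-Real.pi) Real.pi)).map Circle.exp

/-- The derivative along the circle: `f'(z) = d/dt f(z e^{it})` at `t = 0`. -/
noncomputable def circleDeriv (f : Circle → ℝ) (z : Circle) : ℝ :=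
  deriv (fun t : ℝ => f (z * Circle.exp t)) 0

/-- A smooth probability measure on the circle: a probability measure whose density with respect
to the Haar measure is continuously differentiable (every `C^∞` density is allowed). -/
def IsSmoothProbability (μ : Measure Circle) : Prop :=
  IsProbabilityMeasure μ ∧
    ∃ f : Circle → ℝ, ContMDiff (𝓡 1) 𝓘(ℝ, ℝ) 1 f ∧ (∀ z, 0 ≤ f z) ∧
      μ = circleHaar.withDensity (fun z => ENNReal.ofReal (f z))

/-- `log |z - w|` as an extended real number (`-∞` on the diagonal). -/
noncomputable def logDist (z w : Circle) : EReal :=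
  ENNReal.log ‖(z : ℂ) - (w : ℂ)‖ₑ

/-- The double integral `∬ log |z - w| μ(dz) μ(dw) ∈ [-∞, ∞)`, as the integral of the positive part
(which is at most `log 2` for a probability measure) minus the integral of the negative part. -/
noncomputable def logIntegral (μ : Measure Circle) : EReal :=
  ((∫⁻ p : Circle × Circle, (logDist p.1 p.2).toENNReal ∂(μ.prod μ) : ℝ≥0∞) : EReal) -
    ((∫⁻ p : Circle × Circle, (-logDist p.1 p.2).toENNReal ∂(μ.prod μ) : ℝ≥0∞) : EReal)

/-- The logarithmic energy with external field `Q`,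
`E_Q(μ) = ∫ Q dμ - ∬ log |z - w| μ(dz) μ(dw) ∈ (-∞, ∞]`. -/
noncomputable def logEnergy (Q : Circle → ℝ) (μ : Measure Circle) : EReal :=
  ((∫ z, Q z ∂μ : ℝ) : EReal) - logIntegral μ

/-- `μ` is an equilibrium measure of `Q`: it minimizes `E_Q` over all (Borel) probability measures
on the circle. -/
def IsEquilibriumMeasure (Q : Circle → ℝ) (μ : Measure Circle) : Prop :=
  IsProbabilityMeasure μ ∧
    ∀ ν : Measure Circle, IsProbabilityMeasure ν → logEnergy Q μ ≤ logEnergy Q ν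

/-- The kernel `i (z + w) / (z - w)`, which is real on the circle; for `z = e^{ix}`, `w = e^{iy}` it
is `cot ((x - y) / 2)`, see `hilbertKernel_exp`. -/
noncomputable def hilbertKernel (z w : Circle) : ℝ :=
  (Complex.I * ((z : ℂ) + (w : ℂ)) / ((z : ℂ) - (w : ℂ))).re

theorem hilbertKernel_exp (x y : ℝ) :
    hilbertKernel (Circle.exp x) (Circle.exp y) = Real.cot ((x - y) / 2) := by
  have h : (Real.cot ((x - y) / 2) : ℂ) = Complex.I *
      ((Circle.exp x : ℂ) + (Circle.exp y : ℂ)) / ((Circle.exp x : ℂ) - (Circle.exp y : ℂ)) := by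
    rw [Complex.ofReal_cot, Complex.cot_eq_exp_ratio, Circle.coe_exp, Circle.coe_exp]
    have e : Complex.exp (2 * Complex.I * (((x - y) / 2 : ℝ) : ℂ)) =
        Complex.exp (x * Complex.I) / Complex.exp (y * Complex.I) := by
      rw [← Complex.exp_sub]; congr 1; push_cast; ring
    rw [e]
    have hy := Complex.exp_ne_zero (y * Complex.I)
    generalize Complex.exp (x * Complex.I) = a at *
    generalize Complex.exp (y * Complex.I) = b at *
    by_cases hab : a = b
    · rw [hab, div_self hy]; simp
    · have h1 : a - b ≠ 0 := sub_ne_zero.2 hab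
      have h2 : a / b + 1 = (a + b) / b := by field_simp
      have h3 : Complex.I * (1 - a / b) = -Complex.I * (a - b) / b := by field_simp; ring
      have h4 : Complex.I * Complex.I = -1 := Complex.I_mul_I
      rw [h2, h3, div_div_div_cancel_right₀ hy, div_eq_div_iff (mul_ne_zero (neg_ne_zero.2 Complex.I_ne_zero) h1) h1]
      linear_combination (a + b) * (a - b) * h4
  unfold hilbertKernel
  rw [← h, Complex.ofReal_re]

/-- The truncated circular Hilbert transform, the arc around `z` of chordal radius `ε` removed. -/
noncomputable def truncHilbert (μ : Measure Circle) (ε : ℝ) (z : Circle) : ℝ :=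
  ∫ w in {w : Circle | ε < ‖(z : ℂ) - (w : ℂ)‖}, hilbertKernel z w ∂μ

/-- `H` is the circular Hilbert transform of `μ`:
`H z = p.v. ∫ cot ((x - y) / 2) μ(d e^{iy})` for every `z = e^{ix}`, the limit existing. -/
def IsHilbertTransform (μ : Measure Circle) (H : Circle → ℝ) : Prop :=
  ∀ z : Circle, Filter.Tendsto (fun ε : ℝ => truncHilbert μ ε z) (𝓝[>] 0) (𝓝 (H z))

/-- The free Fisher information `∫ (H - Q')² dμ - (∫ Q' dμ)²`, where `H` is the Hilbert transform
of `μ`. -/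
noncomputable def freeFisher (Q : Circle → ℝ) (μ : Measure Circle) (H : Circle → ℝ) : ℝ :=
  ∫ z, (H z - circleDeriv Q z) ^ 2 ∂μ - (∫ z, circleDeriv Q z ∂μ) ^ 2

/-- The free log-Sobolev inequality `LSI(ρ)` for the potential `Q`. An equilibrium measure `μQ`
exists and has finite energy, and every smooth probability measure `μ` has finite energy, has a
Hilbert transform `H` with `(H - Q')²` integrable, and satisfies
`E_Q(μ) - E_Q(μQ) ≤ (1 / (4 ρ)) I_Q(μ)`. -/
def FreeLogSobolev (Q : Circle → ℝ) (ρ : ℝ) : Prop :=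
  0 < ρ ∧
    ∃ μQ : Measure Circle, IsEquilibriumMeasure Q μQ ∧ logEnergy Q μQ ≠ ⊤ ∧ logEnergy Q μQ ≠ ⊥ ∧
      ∀ μ : Measure Circle, IsSmoothProbability μ →
        logEnergy Q μ ≠ ⊤ ∧
        ∃ H : Circle → ℝ, IsHilbertTransform μ H ∧
          Integrable (fun z => (H z - circleDeriv Q z) ^ 2) μ ∧
          logEnergy Q μ - logEnergy Q μQ ≤ ((1 / (4 * ρ) * freeFisher Q μ H : ℝ) : EReal)

/-! The proof is by optimal transport on the circle. For an atomless probability measure, cutting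
the circle at a point gives a monotone map from `(0,1)` to an interval of length `2π` whose image
under `Circle.exp` has the given law. Moving the cut changes the mean of the lift continuously, so
lifts `X` of `μ` and `Y` of `ν` can both be chosen with mean zero (`exists_monotone_lift`). The
displacement `θ = Y - X` then has mean zero.

On `(0, 2π)` the function `-log sin (u/2)` has second derivative `1 / (4 sin² (u/2)) ≥ 1/4`. A
first-order expansion of the kernel along `θ s - θ t`, integrated over pairs, shows that passing
from `μ` to `ν` changes the logarithmic part of the energy by at least `-∫ θ Hμ + (1/4) ∫ θ²`
(`integral_log_norm_sub_le_of_lift`). Mean zero enters in `∬ (θ s - θ t)² / 8 = (1/4) ∫ θ²`. The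
potential contributes at least `∫ θ Q' + ((ρ - 1/2)/2) ∫ θ²`, so the quadratic terms add up to
`(ρ/2) ∫ θ²`.

Hence `E_Q(μ) - E_Q(ν) ≤ ∫ θ (Hμ - Q' + c) - (ρ/2) ∫ θ²` for every constant `c`, again by mean zero.
Completing the square bounds this by `(1/(2ρ)) ∫ (Hμ - Q' + c)² dμ`. Since `∫ Hμ dμ = 0`, the choice
`c = ∫ Q' dμ` turns the last integral into the free Fisher information (`energy_sub_le_freeFisher`).
The bound holds against any `ν` of finite energy. An equilibrium measure of finite energy exists by
compactness and lower semicontinuity (`exists_isEquilibriumMeasure`). -/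

/-! ### Quantile functions and monotone lifts of circle measures -/

theorem exists_monotone_map_eq (ν : Measure ℝ) [IsProbabilityMeasure ν] {a b : ℝ}
    (hν : ∀ᵐ x ∂ν, x ∈ Set.Icc a b) :
    ∃ Y : ℝ → ℝ, Monotone Y ∧ (∀ s, Y s ∈ Set.Icc a b) ∧
      (volume.restrict (Set.Ioo 0 1)).map Y = ν := by
  have hab : a ≤ b := by
    obtain ⟨x, hx⟩ := hν.exists
    exact hx.1.trans hx.2
  have hb : ∀ x, b ≤ x → ProbabilityTheory.cdf ν x = 1 := by
    intro x hx
    rw [ProbabilityTheory.cdf_eq_real, measureReal_def,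
      (prob_compl_eq_zero_iff measurableSet_Iic).1, ENNReal.toReal_one]
    rw [← mem_ae_iff]
    filter_upwards [hν] with y hy using hy.2.trans hx
  have ha : ∀ x, x < a → ProbabilityTheory.cdf ν x = 0 := by
    intro x hx
    rw [ProbabilityTheory.cdf_eq_real, measureReal_def, ENNReal.toReal_eq_zero_iff]
    left
    rw [← compl_compl (Set.Iic x), ← mem_ae_iff]
    filter_upwards [hν] with y hy
    simp only [Set.mem_compl_iff, Set.mem_Iic, not_le]
    exact hx.trans_le hy.1
  set F := ProbabilityTheory.cdf ν with hF
  -- The infimum of `S s` is the quantile function. Allowing `x = b` keeps `S s` nonempty for every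
  -- real `s`, so the map is monotone and bounded on the whole line.
  let S : ℝ → Set ℝ := fun s => {x | x ∈ Set.Icc a b ∧ (s ≤ F x ∨ x = b)}
  have hSb : ∀ s, b ∈ S s := fun s => ⟨⟨hab, le_rfl⟩, Or.inr rfl⟩
  have hSbdd : ∀ s, BddBelow (S s) := fun s => ⟨a, fun x hx => hx.1.1⟩
  have hmem : ∀ s, sInf (S s) ∈ Set.Icc a b := fun s =>
    ⟨le_csInf ⟨b, hSb s⟩ fun x hx => hx.1.1, csInf_le (hSbdd s) (hSb s)⟩
  have hmono : Monotone fun s => sInf (S s) := by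
    intro s t hst
    refine csInf_le_csInf (hSbdd s) ⟨b, hSb t⟩ fun x hx => ⟨hx.1, ?_⟩
    exact hx.2.imp_left hst.trans
  refine ⟨fun s => sInf (S s), hmono, hmem, ?_⟩
  -- The adjunction between quantile function and distribution function; right continuity of `F`
  -- gives the forward direction.
  have key : ∀ s ∈ Set.Ioo (0 : ℝ) 1, ∀ x, sInf (S s) ≤ x ↔ s ≤ F x := by
    intro s hs x
    constructor
    · intro h
      have hright : ContinuousWithinAt F (Set.Ici x) x := F.right_continuous x
      have hx : ∀ y ∈ Set.Ioi x, s ≤ F y := by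
        intro y hy
        obtain ⟨z, hz, hzy⟩ := (csInf_lt_iff (hSbdd s) ⟨b, hSb s⟩).1 (h.trans_lt hy)
        rcases hz.2 with h1 | h1
        · exact h1.trans (F.mono hzy.le)
        · rw [hb y (h1 ▸ hzy.le)]; exact hs.2.le
      refine ge_of_tendsto (hright.mono Set.Ioi_subset_Ici_self) ?_
      filter_upwards [self_mem_nhdsWithin] with y hy using hx y hy
    · intro h
      by_cases hxa : x < a
      · rw [ha x hxa] at h; exact absurd h (not_le.2 hs.1)
      by_cases hxb : b ≤ x
      · exact (hmem s).2.trans hxb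
      · exact csInf_le (hSbdd s) ⟨⟨not_lt.1 hxa, (not_le.1 hxb).le⟩, Or.inl h⟩
  have hprob : IsProbabilityMeasure (volume.restrict (Set.Ioo (0 : ℝ) 1)) :=
    ⟨by simp⟩
  have : IsProbabilityMeasure ((volume.restrict (Set.Ioo (0 : ℝ) 1)).map fun s => sInf (S s)) :=
    Measure.isProbabilityMeasure_map (f := fun s => sInf (S s)) hmono.measurable.aemeasurable
  refine Measure.ext_of_Iic _ _ fun x => ?_
  rw [Measure.map_apply hmono.measurable measurableSet_Iic,
    Measure.restrict_apply (hmono.measurable measurableSet_Iic), ← ProbabilityTheory.ofReal_cdf ν x,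
    ← hF]
  have h0 : 0 ≤ F x := ProbabilityTheory.cdf_nonneg ν x
  have h1 : F x ≤ 1 := ProbabilityTheory.cdf_le_one ν x
  have e : (fun s => sInf (S s)) ⁻¹' Set.Iic x ∩ Set.Ioo 0 1 = Set.Iic (F x) ∩ Set.Ioo 0 1 := by
    ext s
    simp only [Set.mem_inter_iff, Set.mem_preimage, Set.mem_Iic]
    exact and_congr_left fun hs => key s hs x
  rw [e]
  refine le_antisymm ?_ ?_
  · calc volume (Set.Iic (F x) ∩ Set.Ioo 0 1) ≤ volume (Set.Ioc 0 (F x)) :=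
          measure_mono fun s hs => ⟨hs.2.1, hs.1⟩
      _ = _ := by simp
  · calc ENNReal.ofReal (F x) = volume (Set.Ioo 0 (F x)) := by simp
      _ ≤ volume (Set.Iic (F x) ∩ Set.Ioo 0 1) := measure_mono fun s hs => ⟨hs.2.le, hs.1, hs.2.trans_le h1⟩

theorem Circle.measurable_coe : Measurable fun z : Circle => (z : ℂ) :=
  Continuous.measurable (f := fun z : Circle => (z : ℂ)) continuous_subtype_val

/-- As a function of the cut `a`, the representative jumps only when `b` is congruent to `a`, where
its value is the right endpoint `a + p`. -/
theorem continuousAt_toIocMod_left {p : ℝ} (hp : 0 < p) {a b : ℝ}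
    (h : toIocMod hp a b ≠ a + p) : ContinuousAt (fun a => toIocMod hp a b) a := by
  have e : (fun a => toIocMod hp a b) = fun a => toIocMod hp 0 (b - a) + a :=
    funext fun c => toIocMod_eq_sub hp c b
  rw [e]
  refine ContinuousAt.add (ContinuousAt.comp (g := toIocMod hp 0) (f := fun a => b - a)
    (continuousAt_toIocMod hp 0 fun hmod => h ?_) (by fun_prop)) continuousAt_id
  rw [toIocMod_eq_sub, hmod.symm.toIcoMod_eq_right, zero_add, add_comm]

/-- The cut `a` is the free parameter that adjusts the mean to `m`. Without atoms the mean depends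
continuously on `a`, and the intermediate value theorem applies. -/
theorem exists_monotone_lift (ν : Measure Circle) [IsProbabilityMeasure ν]
    (hν : ∀ z, ν {z} = 0) (m : ℝ) :
    ∃ (a : ℝ) (Y : ℝ → ℝ), Monotone Y ∧ (∀ s, Y s ∈ Set.Icc a (a + 2 * Real.pi)) ∧
      (volume.restrict (Set.Ioo 0 1)).map (fun s => Circle.exp (Y s)) = ν ∧
      ∫ s in Set.Ioo 0 1, Y s = m := by
  have hp := Real.two_pi_pos
  have hmeasarg : Measurable fun z : Circle => Complex.arg z :=
    Complex.measurable_arg.comp Circle.measurable_coe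
  let g : ℝ → Circle → ℝ := fun a z => toIocMod hp a (Complex.arg z)
  have hg : ∀ a z, g a z ∈ Set.Ioc a (a + 2 * Real.pi) := fun a z => toIocMod_mem_Ioc hp a _
  have hgm : ∀ a, Measurable (g a) := by
    intro a
    have e : g a = fun z : Circle => a + 2 * Real.pi -
        Int.fract ((a + 2 * Real.pi - Complex.arg z) / (2 * Real.pi)) * (2 * Real.pi) :=
      funext fun z => toIocMod_eq_sub_fract_mul hp a _
    rw [e]
    fun_prop
  have hexp : ∀ a z, Circle.exp (g a z) = z := by
    intro a z
    simp only [g, toIocMod]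
    rw [zsmul_eq_mul, Circle.periodic_exp.sub_int_mul_eq, Circle.exp_arg]
  have hgi : ∀ a, Integrable (g a) ν := fun a =>
    Integrable.of_bound (hgm a).aestronglyMeasurable (max |a| |a + 2 * Real.pi|)
      (Filter.Eventually.of_forall fun z => abs_le_max_abs_abs (hg a z).1.le (hg a z).2)
  have hcont : Continuous fun a => ∫ z, g a z ∂ν := by
    refine continuous_iff_continuousAt.2 fun a => ?_
    refine continuousAt_of_dominated (bound := fun _ => |a| + 1 + 2 * Real.pi)
      (Filter.Eventually.of_forall fun b => (hgm b).aestronglyMeasurable) ?_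
      (integrable_const _) ?_
    · filter_upwards [Metric.ball_mem_nhds a one_pos] with b hb
      refine Filter.Eventually.of_forall fun z => ?_
      have h1 := (hg b z).1
      have h2 := (hg b z).2
      rw [Metric.mem_ball, Real.dist_eq, abs_lt] at hb
      rw [Real.norm_eq_abs, abs_le]
      constructor
      · linarith [neg_abs_le a]
      · linarith [le_abs_self a]
    · have : ∀ᵐ z ∂ν, z ≠ Circle.exp a := by
        rw [ae_iff]; simpa using hν (Circle.exp a)
      filter_upwards [this] with z hz
      refine continuousAt_toIocMod_left hp fun h => hz ?_
      rw [← hexp a z, show g a z = _ from h, Circle.periodic_exp]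
  -- With the cut at `m - 2π` all representatives are at most `m`; with the cut at `m` they all
  -- exceed `m`.
  obtain ⟨a, -, ha⟩ : ∃ a ∈ Set.Icc (m - 2 * Real.pi) m, ∫ z, g a z ∂ν = m := by
    refine intermediate_value_Icc (by linarith) hcont.continuousOn ⟨?_, ?_⟩
    · calc ∫ z, g (m - 2 * Real.pi) z ∂ν ≤ ∫ z, m ∂ν := integral_mono (hgi _) (integrable_const _)
            fun z => (hg (m - 2 * Real.pi) z).2.trans (sub_add_cancel m _).le
        _ = m := by simp
    · calc m = ∫ z, m ∂ν := by simp
        _ ≤ _ := integral_mono (integrable_const _) (hgi _) fun z => (hg m z).1.le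
  have : IsProbabilityMeasure (ν.map (g a)) :=
    Measure.isProbabilityMeasure_map (hgm a).aemeasurable
  obtain ⟨Y, hY, hYm, hYmap⟩ := exists_monotone_map_eq (ν.map (g a)) (a := a)
    (b := a + 2 * Real.pi) ((ae_map_iff (hgm a).aemeasurable measurableSet_Icc).2
      (Filter.Eventually.of_forall fun z => Set.Ioc_subset_Icc_self (hg a z)))
  refine ⟨a, Y, hY, hYm, ?_, ?_⟩
  · have h1 : (fun s => Circle.exp (Y s)) = Circle.exp ∘ Y := rfl
    rw [h1, ← Measure.map_map Circle.exp.continuous.measurable hY.measurable, hYmap,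
      Measure.map_map Circle.exp.continuous.measurable (hgm a)]
    have h2 : Circle.exp ∘ g a = id := funext (hexp a)
    rw [h2, Measure.map_id]
  · have h1 := integral_map (μ := volume.restrict (Set.Ioo (0 : ℝ) 1)) hY.measurable.aemeasurable
      (f := fun x => x) aestronglyMeasurable_id
    have h2 := integral_map (μ := ν) (hgm a).aemeasurable (f := fun x => x) aestronglyMeasurable_id
    rw [← h1, hYmap, h2, ha]

/-! ### The logarithmic kernel and measures of finite energy -/

theorem logDist_self (z : Circle) : logDist z z = ⊥ := by
  simp [logDist]

theorem logDist_of_ne {z w : Circle} (h : z ≠ w) :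
    logDist z w = ((Real.log ‖(z : ℂ) - (w : ℂ)‖ : ℝ) : EReal) := by
  have h0 : (z : ℂ) - w ≠ 0 := sub_ne_zero.2 fun e => h (Circle.coe_injective e)
  rw [logDist, ← ofReal_norm, ENNReal.log_ofReal_of_pos (norm_pos_iff.2 h0)]

theorem Circle.norm_coe_sub_le (z w : Circle) : ‖(z : ℂ) - (w : ℂ)‖ ≤ 2 := by
  calc ‖(z : ℂ) - (w : ℂ)‖ ≤ ‖(z : ℂ)‖ + ‖(w : ℂ)‖ := norm_sub_le _ _
    _ = 2 := by rw [Circle.norm_coe, Circle.norm_coe]; norm_num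

theorem Circle.measurable_norm_coe_sub :
    Measurable fun p : Circle × Circle => ‖(p.1 : ℂ) - (p.2 : ℂ)‖ :=
  ((Circle.measurable_coe.comp measurable_fst).sub
    (Circle.measurable_coe.comp measurable_snd)).norm

theorem measurable_logDist : Measurable fun p : Circle × Circle => logDist p.1 p.2 := by
  have := ((Circle.measurable_coe.comp measurable_fst).sub
    (Circle.measurable_coe.comp (measurable_snd (α := Circle) (β := Circle)))).enorm
  exact ENNReal.measurable_log.comp this

theorem log_norm_sub_le (z w : Circle) : Real.log ‖(z : ℂ) - (w : ℂ)‖ ≤ Real.log 2 := by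
  rcases (norm_nonneg ((z : ℂ) - (w : ℂ))).eq_or_lt with h | h
  · rw [← h, Real.log_zero]; positivity
  · exact Real.log_le_log h (Circle.norm_coe_sub_le z w)

theorem logDist_le (z w : Circle) : logDist z w ≤ ((Real.log 2 : ℝ) : EReal) := by
  by_cases h : z = w
  · rw [h, logDist_self]; exact bot_le
  · rw [logDist_of_ne h]; exact_mod_cast log_norm_sub_le z w

theorem lintegral_logDist_pos_le (ν : Measure (Circle × Circle)) [IsProbabilityMeasure ν] :
    ∫⁻ p, (logDist p.1 p.2).toENNReal ∂ν ≤ ENNReal.ofReal (Real.log 2) := by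
  calc _ ≤ ∫⁻ p : Circle × Circle, ENNReal.ofReal (Real.log 2) ∂ν := by
        refine lintegral_mono fun p => ?_
        rw [← EReal.real_coe_toENNReal]
        exact EReal.toENNReal_le_toENNReal (logDist_le _ _)
    _ = _ := by simp

theorem lintegral_logDist_pos_ne_top (ν : Measure (Circle × Circle)) [IsProbabilityMeasure ν] :
    ∫⁻ p, (logDist p.1 p.2).toENNReal ∂ν ≠ ⊤ :=
  ne_top_of_le_ne_top ENNReal.ofReal_ne_top (lintegral_logDist_pos_le ν)

/-- The negative part of the logarithmic double integral. -/
noncomputable def logNegPart (ν : Measure Circle) : ℝ≥0∞ :=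
  ∫⁻ p : Circle × Circle, (-logDist p.1 p.2).toENNReal ∂(ν.prod ν)

/-- The negative part of the kernel is infinite on the diagonal. Hence measures of finite energy
have no atoms, as the lifts require. -/
theorem measure_diagonal_eq_zero {ν : Measure Circle} [IsProbabilityMeasure ν]
    (h : logNegPart ν ≠ ⊤) : (ν.prod ν) {p | p.1 = p.2} = 0 := by
  have := ae_lt_top (measurable_logDist.neg.ereal_toENNReal) h
  rw [ae_iff] at this
  refine measure_mono_null (fun p hp => ?_) this
  simp only [Set.mem_ofPred_eq] at hp
  simp [hp, logDist_self]

theorem measure_singleton_eq_zero {ν : Measure Circle} [IsProbabilityMeasure ν]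
    (h : logNegPart ν ≠ ⊤) (z : Circle) : ν {z} = 0 := by
  have h1 : (ν.prod ν) ({z} ×ˢ {z}) = 0 := by
    refine measure_mono_null (fun p hp => ?_) (measure_diagonal_eq_zero h)
    simp only [Set.mem_prod, Set.mem_singleton_iff] at hp
    simp [hp.1, hp.2]
  rw [Measure.prod_prod] at h1
  simpa using h1

theorem ae_ne_of_logNegPart_ne_top {ν : Measure Circle} [IsProbabilityMeasure ν]
    (h : logNegPart ν ≠ ⊤) : ∀ᵐ p ∂(ν.prod ν), p.1 ≠ p.2 := by
  rw [ae_iff]; simpa using measure_diagonal_eq_zero h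

theorem measurable_log_norm_sub :
    Measurable fun p : Circle × Circle => Real.log ‖(p.1 : ℂ) - (p.2 : ℂ)‖ :=
  Real.measurable_log.comp Circle.measurable_norm_coe_sub

theorem integrable_log_norm_sub {ν : Measure Circle} [IsProbabilityMeasure ν]
    (h : logNegPart ν ≠ ⊤) :
    Integrable (fun p : Circle × Circle => Real.log ‖(p.1 : ℂ) - (p.2 : ℂ)‖) (ν.prod ν) := by
  refine ⟨measurable_log_norm_sub.aestronglyMeasurable, ?_⟩
  have hle : ∫⁻ p : Circle × Circle, ‖Real.log ‖(p.1 : ℂ) - (p.2 : ℂ)‖‖ₑ ∂(ν.prod ν) ≤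
      ∫⁻ p : Circle × Circle, ((logDist p.1 p.2).toENNReal + (-logDist p.1 p.2).toENNReal)
        ∂(ν.prod ν) := by
    refine lintegral_mono_ae ?_
    filter_upwards [ae_ne_of_logNegPart_ne_top h] with p hp
    rw [logDist_of_ne hp, ← EReal.coe_neg, EReal.real_coe_toENNReal, EReal.real_coe_toENNReal,
      Real.enorm_eq_ofReal_abs]
    rcases le_total 0 (Real.log ‖(p.1 : ℂ) - (p.2 : ℂ)‖) with h1 | h1
    · rw [abs_of_nonneg h1]; exact le_self_add
    · rw [abs_of_nonpos h1]; exact le_add_self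
  refine hle.trans_lt ?_
  rw [lintegral_add_left measurable_logDist.ereal_toENNReal]
  exact ENNReal.add_lt_top.2 ⟨(lintegral_logDist_pos_ne_top _).lt_top, Ne.lt_top h⟩

theorem logIntegral_eq_coe {ν : Measure Circle} [IsProbabilityMeasure ν]
    (h : logNegPart ν ≠ ⊤) :
    logIntegral ν =
      ((∫ p : Circle × Circle, Real.log ‖(p.1 : ℂ) - (p.2 : ℂ)‖ ∂(ν.prod ν) : ℝ) : EReal) := by
  rw [integral_eq_lintegral_pos_part_sub_lintegral_neg_part (integrable_log_norm_sub h)]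
  have e1 : ∫⁻ p : Circle × Circle, ENNReal.ofReal (Real.log ‖(p.1 : ℂ) - (p.2 : ℂ)‖) ∂(ν.prod ν)
      = ∫⁻ p : Circle × Circle, (logDist p.1 p.2).toENNReal ∂(ν.prod ν) := by
    refine lintegral_congr_ae ?_
    filter_upwards [ae_ne_of_logNegPart_ne_top h] with p hp
    rw [logDist_of_ne hp, EReal.real_coe_toENNReal]
  have e2 : ∫⁻ p : Circle × Circle, ENNReal.ofReal (-Real.log ‖(p.1 : ℂ) - (p.2 : ℂ)‖) ∂(ν.prod ν)
      = logNegPart ν := by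
    refine lintegral_congr_ae ?_
    filter_upwards [ae_ne_of_logNegPart_ne_top h] with p hp
    rw [logDist_of_ne hp, ← EReal.coe_neg, EReal.real_coe_toENNReal]
  have e3 : ∀ A : ℝ≥0∞, A ≠ ⊤ → ((A.toReal : ℝ) : EReal) = A := by
    intro A hA
    lift A to NNReal using hA
    rfl
  rw [e1, e2, EReal.coe_sub, e3 _ (lintegral_logDist_pos_ne_top _), e3 _ h]
  rfl

theorem logEnergy_eq_coe (Q : Circle → ℝ) {ν : Measure Circle} [IsProbabilityMeasure ν]
    (h : logNegPart ν ≠ ⊤) :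
    logEnergy Q ν = ((∫ z, Q z ∂ν -
      ∫ p : Circle × Circle, Real.log ‖(p.1 : ℂ) - (p.2 : ℂ)‖ ∂(ν.prod ν) : ℝ) : EReal) := by
  rw [logEnergy, logIntegral_eq_coe h, EReal.coe_sub]

theorem logEnergy_eq_top (Q : Circle → ℝ) {ν : Measure Circle} [IsProbabilityMeasure ν]
    (h : logNegPart ν = ⊤) : logEnergy Q ν = ⊤ := by
  have h1 := lintegral_logDist_pos_ne_top (ν.prod ν)
  have h2 : logIntegral ν = ⊥ := by
    rw [logIntegral]
    rw [show ∫⁻ p : Circle × Circle, (-logDist p.1 p.2).toENNReal ∂(ν.prod ν) = ⊤ from h]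
    lift (∫⁻ p : Circle × Circle, (logDist p.1 p.2).toENNReal ∂(ν.prod ν)) to NNReal using h1
      with x
    rfl
  rw [logEnergy, h2]
  rfl

/-! ### Invariance of Haar measure and finite energy of bounded densities -/

theorem integral_circleHaar {g : Circle → ℝ} (hg : Measurable g) :
    ∫ w, g w ∂circleHaar =
      1 / (2 * Real.pi) * ∫ x in (-Real.pi)..Real.pi, g (Circle.exp x) := by
  have h0 : (0 : ℝ) ≤ 1 / (2 * Real.pi) := by positivity
  rw [circleHaar, integral_smul_measure, ENNReal.toReal_ofReal h0,
    integral_map Circle.exp.continuous.measurable.aemeasurable hg.aestronglyMeasurable,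
    intervalIntegral.integral_of_le (by linarith [Real.pi_pos]), smul_eq_mul]

instance isProbabilityMeasure_circleHaar : IsProbabilityMeasure circleHaar := by
  constructor
  have h0 : (0 : ℝ) ≤ 1 / (2 * Real.pi) := by positivity
  rw [circleHaar, Measure.smul_apply, Measure.map_apply Circle.exp.continuous.measurable .univ,
    smul_eq_mul]
  simp only [Set.preimage_univ, Measure.restrict_apply_univ, Real.volume_Ioc]
  rw [← ENNReal.ofReal_mul h0, ← ENNReal.ofReal_one]
  congr 1
  field_simp
  ring

theorem Circle.measurable_mul_inv (a : Circle) : Measurable fun w : Circle => a * w⁻¹ :=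
  (continuous_const.mul continuous_inv).measurable

/-- Reflections are treated first because rotations are products of two of them, and because the
reflection fixing `z` later cancels the odd Hilbert kernel. -/
theorem measurePreserving_mul_inv (a : Circle) :
    MeasurePreserving (fun w : Circle => a * w⁻¹) circleHaar circleHaar := by
  refine ⟨Circle.measurable_mul_inv a, ?_⟩
  have hm := Circle.measurable_mul_inv a
  have : IsProbabilityMeasure (circleHaar.map fun w : Circle => a * w⁻¹) :=
    Measure.isProbabilityMeasure_map hm.aemeasurable
  refine Measure.ext fun s hs => ?_
  rw [← ofReal_measureReal (μ := circleHaar) (s := s), ← ofReal_measureReal,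
    ← integral_indicator_one hs, ← integral_indicator_one hs,
    integral_map hm.aemeasurable
      ((measurable_one.indicator hs).aestronglyMeasurable)]
  congr 1
  set g : Circle → ℝ := s.indicator 1 with hg
  have hgm : Measurable g := measurable_one.indicator hs
  rw [integral_circleHaar hgm, integral_circleHaar (g := fun x => g (a * x⁻¹)) (hgm.comp hm)]
  congr 1
  obtain ⟨t, rfl⟩ := Circle.exp_surjective a
  have e : ∀ x, g (Circle.exp t * (Circle.exp x)⁻¹) = g (Circle.exp (t - x)) := by
    intro x; rw [Circle.exp_sub, div_eq_mul_inv]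
  simp_rw [e]
  rw [intervalIntegral.integral_comp_sub_left (fun x => g (Circle.exp x))]
  have hper : Function.Periodic (fun x => g (Circle.exp x)) (2 * Real.pi) := fun x => by
    simp only [Circle.periodic_exp x]
  have := hper.intervalIntegral_add_eq (t - Real.pi) (-Real.pi)
  convert this using 2 <;> ring

theorem measurePreserving_mul_left_circleHaar (a : Circle) :
    MeasurePreserving (fun w : Circle => a * w) circleHaar circleHaar := by
  have := (measurePreserving_mul_inv a).comp (measurePreserving_mul_inv 1)
  convert this using 1
  funext w
  simp

/-- The logarithmic singularity is integrable on a period, and periodicity moves the period from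
`(0, 2π]` to `(-π, π]`. -/
theorem lintegral_neg_logDist_one_lt_top :
    ∫⁻ w, (-logDist 1 w).toENNReal ∂circleHaar < ⊤ := by
  have hm : Measurable fun w => (-logDist 1 w).toENNReal :=
    (measurable_logDist.comp (measurable_const.prodMk measurable_id)).neg.ereal_toENNReal
  rw [circleHaar, lintegral_smul_measure, lintegral_map hm Circle.exp.continuous.measurable]
  refine ENNReal.mul_lt_top ENNReal.ofReal_lt_top ?_
  have hi : IntegrableOn (fun x : ℝ => Real.log ‖circleMap 0 1 x - 1‖)
      (Set.Ioc (-Real.pi) Real.pi) := by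
    have h1 : CircleIntegrable (fun z : ℂ => Real.log ‖z - 1‖) 0 1 :=
      circleIntegrable_log_norm_sub_const 1
    have hper : Function.Periodic (fun x : ℝ => Real.log ‖circleMap 0 1 x - 1‖)
        (2 * Real.pi) := fun x => by simp only [periodic_circleMap 0 1 x]
    have h2 : IntervalIntegrable (fun x : ℝ => Real.log ‖circleMap 0 1 x - 1‖) volume
        0 (0 + 2 * Real.pi) := by rw [zero_add]; exact h1
    exact (intervalIntegrable_iff_integrableOn_Ioc_of_le (by linarith [Real.pi_pos])).1
      (hper.intervalIntegrable Real.two_pi_pos.ne' h2 (-Real.pi) Real.pi)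
  refine lt_of_le_of_lt (lintegral_mono_ae ?_) hi.2
  have hne : ∀ᵐ x ∂(volume.restrict (Set.Ioc (-Real.pi) Real.pi)), x ≠ 0 :=
    ae_restrict_of_ae (by rw [ae_iff]; simp)
  filter_upwards [hne, ae_restrict_mem measurableSet_Ioc] with x hx hxI
  have h1 : (1 : Circle) ≠ Circle.exp x := by
    intro h
    apply hx
    rw [← Circle.arg_exp hxI.1 hxI.2, ← h]
    simp
  rw [logDist_of_ne h1, ← EReal.coe_neg, EReal.real_coe_toENNReal, Real.enorm_eq_ofReal_abs]
  refine ENNReal.ofReal_le_ofReal ?_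
  have e : ‖((1 : Circle) : ℂ) - (Circle.exp x : ℂ)‖ = ‖circleMap 0 1 x - 1‖ := by
    rw [norm_sub_rev]; simp [circleMap]
  rw [e]
  exact neg_le_abs _

theorem logDist_mul_left (a z w : Circle) : logDist (a * z) (a * w) = logDist z w := by
  rw [logDist, logDist, ← ofReal_norm, ← ofReal_norm, Circle.coe_mul, Circle.coe_mul, ← mul_sub,
    norm_mul, Circle.norm_coe, one_mul]

theorem lintegral_neg_logDist (z : Circle) :
    ∫⁻ w, (-logDist z w).toENNReal ∂circleHaar = ∫⁻ w, (-logDist 1 w).toENNReal ∂circleHaar := by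
  have hm : Measurable fun w => (-logDist z w).toENNReal :=
    (measurable_logDist.comp (measurable_const.prodMk measurable_id)).neg.ereal_toENNReal
  rw [← (measurePreserving_mul_left_circleHaar z).lintegral_comp hm]
  refine lintegral_congr fun w => ?_
  conv_lhs => rw [← mul_one z, mul_assoc, one_mul, logDist_mul_left]

/-- By rotation invariance the integral of the negative kernel against Haar measure does not depend
on the base point, so a bounded density gives a uniform bound. -/
theorem logNegPart_ne_top_of_le {ν : Measure Circle} [IsProbabilityMeasure ν] {C : ℝ≥0∞}
    (hC : C ≠ ⊤) (h : ν ≤ C • circleHaar) : logNegPart ν ≠ ⊤ := by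
  have hm : Measurable fun p : Circle × Circle => (-logDist p.1 p.2).toENNReal :=
    measurable_logDist.neg.ereal_toENNReal
  rw [logNegPart, lintegral_prod _ hm.aemeasurable]
  refine ne_top_of_le_ne_top (b := C * ∫⁻ w, (-logDist 1 w).toENNReal ∂circleHaar)
    (ENNReal.mul_ne_top hC lintegral_neg_logDist_one_lt_top.ne) ?_
  calc _ ≤ ∫⁻ _, C * ∫⁻ w, (-logDist 1 w).toENNReal ∂circleHaar ∂ν := by
        refine lintegral_mono fun z => ?_
        calc _ ≤ ∫⁻ w, (-logDist z w).toENNReal ∂(C • circleHaar) := lintegral_mono' h le_rfl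
          _ = _ := by rw [lintegral_smul_measure, lintegral_neg_logDist, smul_eq_mul]
    _ = _ := by simp

theorem logNegPart_circleHaar_ne_top : logNegPart circleHaar ≠ ⊤ :=
  logNegPart_ne_top_of_le ENNReal.one_ne_top (by rw [one_smul])

/-! ### Lower semicontinuity of the energy and existence of equilibrium measures -/

/-- The truncated logarithmic kernel `log (max ‖z - w‖ r)`. -/
noncomputable def truncLog (r : ℝ) (p : Circle × Circle) : ℝ :=
  Real.log (max ‖(p.1 : ℂ) - (p.2 : ℂ)‖ r)

theorem continuous_truncLog {r : ℝ} (hr : 0 < r) : Continuous (truncLog r) := by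
  have h1 : Continuous fun p : Circle × Circle => ‖(p.1 : ℂ) - (p.2 : ℂ)‖ :=
    ((continuous_subtype_val.comp continuous_fst).sub
      (continuous_subtype_val.comp continuous_snd)).norm
  exact (h1.max continuous_const).log fun p => (hr.trans_le (le_max_right _ _)).ne'

theorem continuous_lintegral_prod_self {g : Circle × Circle → ℝ} (hg : Continuous g) :
    Continuous fun ν : ProbabilityMeasure Circle =>
      ∫⁻ p, ENNReal.ofReal (g p) ∂((ν : Measure Circle).prod (ν : Measure Circle)) := by
  have hc : Continuous fun ν : ProbabilityMeasure Circle => ν.prod ν :=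
    ProbabilityMeasure.continuous_prod.comp (continuous_id.prodMk continuous_id)
  let G : BoundedContinuousFunction (Circle × Circle) NNReal :=
    BoundedContinuousFunction.mkOfCompact ⟨fun p => (g p).toNNReal, continuous_real_toNNReal.comp hg⟩
  refine continuous_iff_continuousAt.2 fun ν => ?_
  exact (ProbabilityMeasure.tendsto_iff_forall_lintegral_tendsto.1 hc.continuousAt) G

/-- At level `exp (-k)` the truncated value is `min (-log ‖z - w‖) k` off the diagonal and `k` on
it. -/
theorem neg_logDist_toENNReal_eq_iSup (p : Circle × Circle) :
    (-logDist p.1 p.2).toENNReal = ⨆ k : ℕ, ENNReal.ofReal (-truncLog (Real.exp (-(k : ℝ))) p) := by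
  by_cases hp : p.1 = p.2
  · rw [hp, logDist_self]
    have : ∀ k : ℕ, -truncLog (Real.exp (-(k : ℝ))) p = k := fun k => by
      rw [truncLog, hp, sub_self, norm_zero, max_eq_right (Real.exp_pos _).le, Real.log_exp,
        neg_neg]
    simp_rw [this, ENNReal.ofReal_natCast]
    rw [ENNReal.iSup_natCast]
    rfl
  · have hpos : 0 < ‖(p.1 : ℂ) - (p.2 : ℂ)‖ :=
      norm_pos_iff.2 (sub_ne_zero.2 fun e => hp (Circle.coe_injective e))
    rw [logDist_of_ne hp, ← EReal.coe_neg, EReal.real_coe_toENNReal]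
    refine le_antisymm ?_ (iSup_le fun k => ENNReal.ofReal_le_ofReal
      (neg_le_neg (Real.log_le_log hpos (le_max_left _ _))))
    obtain ⟨k, hk⟩ := exists_nat_ge (-Real.log ‖(p.1 : ℂ) - (p.2 : ℂ)‖)
    refine le_iSup_of_le k (ENNReal.ofReal_le_ofReal (neg_le_neg ?_))
    rw [truncLog, max_eq_left]
    rw [← Real.le_log_iff_exp_le hpos]
    linarith

/-- Monotone convergence makes this a supremum of integrals of continuous kernels, each weakly
continuous in the measure. -/
theorem lowerSemicontinuous_logNegPart :
    LowerSemicontinuous fun ν : ProbabilityMeasure Circle => logNegPart (ν : Measure Circle) := by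
  have e : (fun ν : ProbabilityMeasure Circle => logNegPart (ν : Measure Circle)) =
      fun ν : ProbabilityMeasure Circle => ⨆ k : ℕ,
        ∫⁻ p, ENNReal.ofReal (-truncLog (Real.exp (-(k : ℝ))) p)
          ∂((ν : Measure Circle).prod (ν : Measure Circle)) := by
    funext ν
    rw [← lintegral_iSup]
    · exact lintegral_congr neg_logDist_toENNReal_eq_iSup
    · exact fun k => (continuous_truncLog (Real.exp_pos _)).neg.measurable.ennreal_ofReal
    · intro k l hkl p
      refine ENNReal.ofReal_le_ofReal (neg_le_neg (Real.log_le_log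
        ((Real.exp_pos _).trans_le (le_max_right _ _)) (max_le_max le_rfl ?_)))
      exact Real.exp_le_exp.2 (neg_le_neg (Nat.cast_le.2 hkl))
  rw [e]
  exact lowerSemicontinuous_iSup fun k =>
    (continuous_lintegral_prod_self (continuous_truncLog (Real.exp_pos _)).neg).lowerSemicontinuous

/-- The positive part is itself a continuous kernel, so its integral is weakly continuous. -/
theorem logDist_toENNReal_eq (p : Circle × Circle) :
    (logDist p.1 p.2).toENNReal = ENNReal.ofReal (truncLog 1 p) := by
  by_cases hp : p.1 = p.2
  · rw [truncLog, hp, logDist_self]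
    simp
  · have hpos : 0 < ‖(p.1 : ℂ) - (p.2 : ℂ)‖ :=
      norm_pos_iff.2 (sub_ne_zero.2 fun e => hp (Circle.coe_injective e))
    rw [logDist_of_ne hp, EReal.real_coe_toENNReal, truncLog]
    rcases le_total ‖(p.1 : ℂ) - (p.2 : ℂ)‖ 1 with h | h
    · rw [max_eq_right h, Real.log_one, ENNReal.ofReal_zero,
        ENNReal.ofReal_of_nonpos (Real.log_nonpos hpos.le h)]
    · rw [max_eq_left h]

theorem continuous_logPosPart :
    Continuous fun ν : ProbabilityMeasure Circle =>
      (∫⁻ p : Circle × Circle, (logDist p.1 p.2).toENNReal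
        ∂((ν : Measure Circle).prod (ν : Measure Circle))).toReal := by
  have h := continuous_lintegral_prod_self (continuous_truncLog one_pos)
  simp_rw [logDist_toENNReal_eq]
  refine continuous_iff_continuousAt.2 fun ν => ?_
  refine (ENNReal.continuousAt_toReal ?_).comp h.continuousAt
  simp_rw [← logDist_toENNReal_eq]
  exact lintegral_logDist_pos_ne_top _

/-- All infinite values are confined to the second summand, so no `∞ - ∞` can occur when
semicontinuity is added up. -/
theorem logEnergy_eq_add (Q : Circle → ℝ) (ν : Measure Circle) [IsProbabilityMeasure ν] :
    logEnergy Q ν = ((∫ z, Q z ∂ν -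
      (∫⁻ p : Circle × Circle, (logDist p.1 p.2).toENNReal ∂(ν.prod ν)).toReal : ℝ) : EReal) +
        (logNegPart ν : EReal) := by
  have h1 := lintegral_logDist_pos_ne_top (ν.prod ν)
  rw [logEnergy, logIntegral, ← logNegPart]
  lift (∫⁻ p : Circle × Circle, (logDist p.1 p.2).toENNReal ∂(ν.prod ν)) to NNReal using h1
    with x
  induction logNegPart ν with
  | top => rfl
  | coe y =>
    change ((_ : ℝ) : EReal) - (((x : ℝ) : EReal) - ((y : ℝ) : EReal)) =
      ((_ : ℝ) : EReal) + ((y : ℝ) : EReal)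
    rw [← EReal.coe_sub, ← EReal.coe_sub, ← EReal.coe_add]
    congr 1
    change _ = _ - (x : ℝ) + _
    ring

theorem lowerSemicontinuous_logEnergy {Q : Circle → ℝ} (hQ : Continuous Q) :
    LowerSemicontinuous fun ν : ProbabilityMeasure Circle => logEnergy Q (ν : Measure Circle) := by
  simp_rw [logEnergy_eq_add]
  have h1 : Continuous fun ν : ProbabilityMeasure Circle => ∫ z, Q z ∂(ν : Measure Circle) :=
    continuous_iff_continuousAt.2 fun ν =>
      (ProbabilityMeasure.tendsto_iff_forall_integral_tendsto.1 Filter.tendsto_id)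
        (BoundedContinuousFunction.mkOfCompact ⟨Q, hQ⟩)
  refine LowerSemicontinuous.add' (f := fun ν : ProbabilityMeasure Circle =>
      ((∫ z, Q z ∂(ν : Measure Circle) - (∫⁻ p : Circle × Circle, (logDist p.1 p.2).toENNReal
        ∂((ν : Measure Circle).prod (ν : Measure Circle))).toReal : ℝ) : EReal))
    (continuous_coe_real_ereal.comp (h1.sub continuous_logPosPart)).lowerSemicontinuous
    (continuous_coe_ennreal_ereal.comp_lowerSemicontinuous lowerSemicontinuous_logNegPart
      fun a b h => EReal.coe_ennreal_le_coe_ennreal_iff.2 h) fun ν => ?_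
  exact EReal.continuousAt_add (Or.inl (EReal.coe_ne_top _)) (Or.inl (EReal.coe_ne_bot _))

/-- Probability measures on the circle form a weakly compact space, so the lower semicontinuous
energy attains its minimum; Haar measure is a competitor of finite energy. -/
theorem exists_isEquilibriumMeasure {Q : Circle → ℝ} (hQ : Continuous Q) :
    ∃ μ, IsEquilibriumMeasure Q μ ∧ logNegPart μ ≠ ⊤ := by
  have : Nonempty (ProbabilityMeasure Circle) := ⟨⟨circleHaar, inferInstance⟩⟩
  obtain ⟨μ, -, hμ⟩ := (lowerSemicontinuous_logEnergy hQ).lowerSemicontinuousOn Set.univ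
    |>.exists_isMinOn Set.univ_nonempty isCompact_univ
  have hmin : ∀ ν : Measure Circle, IsProbabilityMeasure ν →
      logEnergy Q (μ : Measure Circle) ≤ logEnergy Q ν := fun ν hν => hμ (Set.mem_univ ⟨ν, hν⟩)
  refine ⟨μ, ⟨inferInstance, hmin⟩, fun h => ?_⟩
  have h2 := hmin circleHaar inferInstance
  rw [logEnergy_eq_top Q h, logEnergy_eq_coe Q logNegPart_circleHaar_ne_top, top_le_iff] at h2
  exact EReal.coe_ne_top _ h2

/-! ### The Hilbert kernel and the Hilbert transform of a smooth density -/

theorem Circle.norm_exp_sub_exp (x y : ℝ) :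
    ‖(Circle.exp x : ℂ) - (Circle.exp y : ℂ)‖ = 2 * |Real.sin ((x - y) / 2)| := by
  have h : (Circle.exp x : ℂ) - (Circle.exp y : ℂ) =
      (Circle.exp y : ℂ) * (Complex.exp (Complex.I * ((x - y : ℝ) : ℂ)) - 1) := by
    rw [mul_sub, mul_one, Circle.coe_exp, Circle.coe_exp, ← Complex.exp_add]
    congr 2
    push_cast
    ring
  rw [h, norm_mul, Circle.norm_coe, one_mul, Complex.norm_exp_I_mul_ofReal_sub_one, norm_mul,
    Real.norm_eq_abs, Real.norm_eq_abs, abs_two]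

theorem hilbertKernel_eq (z w : Circle) :
    hilbertKernel z w = (Complex.I * ((z : ℂ) + (w : ℂ)) / ((z : ℂ) - (w : ℂ))).re := rfl

theorem measurable_hilbertKernel :
    Measurable fun p : Circle × Circle => hilbertKernel p.1 p.2 := by
  have h1 : Measurable fun p : Circle × Circle => (p.1 : ℂ) :=
    Circle.measurable_coe.comp measurable_fst
  have h2 : Measurable fun p : Circle × Circle => (p.2 : ℂ) :=
    Circle.measurable_coe.comp measurable_snd
  exact Complex.measurable_re.comp (((h1.add h2).const_mul Complex.I).div (h1.sub h2))

theorem hilbertKernel_swap (z w : Circle) : hilbertKernel w z = -hilbertKernel z w := by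
  rw [hilbertKernel_eq, hilbertKernel_eq, ← Complex.neg_re, ← neg_sub (z : ℂ) w, div_neg,
    add_comm]

theorem abs_hilbertKernel_mul_le (z w : Circle) :
    |hilbertKernel z w| * ‖(z : ℂ) - (w : ℂ)‖ ≤ 2 := by
  have h1 : |hilbertKernel z w| ≤ ‖(z : ℂ) + (w : ℂ)‖ / ‖(z : ℂ) - (w : ℂ)‖ := by
    rw [hilbertKernel_eq]
    refine (Complex.abs_re_le_norm _).trans ?_
    rw [norm_div, norm_mul, Complex.norm_I, one_mul]
  have h2 : ‖(z : ℂ) + (w : ℂ)‖ ≤ 2 := by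
    calc ‖(z : ℂ) + (w : ℂ)‖ ≤ ‖(z : ℂ)‖ + ‖(w : ℂ)‖ := norm_add_le _ _
      _ = 2 := by rw [Circle.norm_coe, Circle.norm_coe]; norm_num
  rcases (norm_nonneg ((z : ℂ) - (w : ℂ))).eq_or_lt with h | h
  · rw [← h]; norm_num
  · calc _ ≤ ‖(z : ℂ) + (w : ℂ)‖ / ‖(z : ℂ) - (w : ℂ)‖ * ‖(z : ℂ) - (w : ℂ)‖ := by gcongr
      _ = ‖(z : ℂ) + (w : ℂ)‖ := div_mul_cancel₀ _ h.ne'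
      _ ≤ 2 := h2

/-- The truncated kernel of the circular Hilbert transform. -/
noncomputable def truncKernel (ε : ℝ) (z w : Circle) : ℝ :=
  {w : Circle | ε < ‖(z : ℂ) - (w : ℂ)‖}.indicator (hilbertKernel z) w

theorem measurableSet_lt_norm_sub (ε : ℝ) (z : Circle) :
    MeasurableSet {w : Circle | ε < ‖(z : ℂ) - (w : ℂ)‖} :=
  measurableSet_lt measurable_const
    (Circle.measurable_norm_coe_sub.comp (measurable_const.prodMk measurable_id))

theorem measurable_truncKernel (ε : ℝ) :
    Measurable fun p : Circle × Circle => truncKernel ε p.1 p.2 :=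
  measurable_hilbertKernel.indicator
    (measurableSet_lt measurable_const Circle.measurable_norm_coe_sub)

theorem truncHilbert_eq_integral (μ : Measure Circle) (ε : ℝ) (z : Circle) :
    truncHilbert μ ε z = ∫ w, truncKernel ε z w ∂μ :=
  (integral_indicator (measurableSet_lt_norm_sub ε z)).symm

theorem truncKernel_swap (ε : ℝ) (z w : Circle) : truncKernel ε w z = -truncKernel ε z w := by
  simp only [truncKernel, Set.indicator_apply, Set.mem_ofPred_eq, norm_sub_rev (w : ℂ) z]
  split_ifs
  · exact hilbertKernel_swap z w
  · simp

theorem abs_truncKernel_le {ε : ℝ} (hε : 0 < ε) (z w : Circle) : |truncKernel ε z w| ≤ 2 / ε := by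
  rw [truncKernel, Set.indicator_apply]
  split_ifs with h
  · rw [le_div_iff₀ hε]
    refine le_trans ?_ (abs_hilbertKernel_mul_le z w)
    exact mul_le_mul_of_nonneg_left (le_of_lt h) (abs_nonneg _)
  · rw [abs_zero]; positivity

theorem measurable_truncHilbert (μ : Measure Circle) [IsProbabilityMeasure μ] (ε : ℝ) :
    Measurable fun z => truncHilbert μ ε z := by
  simp_rw [truncHilbert_eq_integral]
  exact (measurable_truncKernel ε).stronglyMeasurable.integral_prod_right.measurable

/-- The reflection `w ↦ z² w⁻¹` fixes `z`, preserves Haar measure and changes the sign of the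
kernel. -/
theorem integral_truncKernel_circleHaar (ε : ℝ) (z : Circle) :
    ∫ w, truncKernel ε z w ∂circleHaar = 0 := by
  have hm : Measurable fun w => truncKernel ε z w :=
    (measurable_truncKernel ε).comp (measurable_const.prodMk measurable_id)
  have hmp := measurePreserving_mul_inv (z * z)
  have h1 : ∫ w, truncKernel ε z (z * z * w⁻¹) ∂circleHaar = ∫ w, truncKernel ε z w ∂circleHaar := by
    conv_rhs => rw [← hmp.map_eq]
    rw [integral_map hmp.measurable.aemeasurable hm.aestronglyMeasurable]
  have h2 : ∀ w, truncKernel ε z (z * z * w⁻¹) = -truncKernel ε z w := by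
    intro w
    rw [← truncKernel_swap]
    obtain ⟨x, rfl⟩ := Circle.exp_surjective z
    obtain ⟨y, rfl⟩ := Circle.exp_surjective w
    rw [← Circle.exp_add, ← div_eq_mul_inv, ← Circle.exp_sub]
    simp only [truncKernel, Set.indicator_apply, Set.mem_ofPred_eq, hilbertKernel_exp,
      Circle.norm_exp_sub_exp]
    rw [show x - (x + x - y) = y - x by ring]
  simp_rw [h2, integral_neg] at h1
  linarith

theorem contDiff_comp_circleExp {f : Circle → ℝ} {n : ℕ∞} (hf : ContMDiff (𝓡 1) 𝓘(ℝ, ℝ) n f) :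
    ContDiff ℝ n fun x => f (Circle.exp x) :=
  (hf.comp contMDiff_circleExp).contDiff

theorem abs_le_norm_exp_sub {t x : ℝ} (ht : |t| ≤ Real.pi) :
    |t| ≤ Real.pi / 2 * ‖(Circle.exp (x + t) : ℂ) - (Circle.exp x : ℂ)‖ := by
  rw [Circle.norm_exp_sub_exp, add_sub_cancel_left]
  have h := Real.mul_abs_le_abs_sin (x := t / 2) (by rw [abs_div, abs_two]; linarith)
  rw [abs_div, abs_two] at h
  have := mul_le_mul_of_nonneg_left h Real.pi_pos.le
  have e : Real.pi * (2 / Real.pi * (|t| / 2)) = |t| := by field_simp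
  rw [e] at this
  linarith

theorem exists_lipschitz_bound {f : Circle → ℝ} (hf : ContMDiff (𝓡 1) 𝓘(ℝ, ℝ) 1 f) :
    ∃ L, 0 ≤ L ∧ ∀ z w : Circle, |f z - f w| ≤ L * ‖(z : ℂ) - (w : ℂ)‖ := by
  have hg : ContDiff ℝ 1 fun x => f (Circle.exp x) := contDiff_comp_circleExp (n := 1) hf
  have hd : Continuous (deriv fun x => f (Circle.exp x)) := hg.continuous_deriv le_rfl
  -- Both `arg w` and `arg (z / w)` lie in `(-π, π]`, so this interval contains the segment from `x`
  -- to `x + t`.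
  obtain ⟨C, hC⟩ := (isCompact_Icc (a := -(2 * Real.pi)) (b := 2 * Real.pi)).exists_bound_of_continuousOn
    hd.continuousOn
  have hpi := Real.pi_pos
  have hC0 : 0 ≤ C := (norm_nonneg _).trans (hC 0 ⟨by linarith, by linarith⟩)
  refine ⟨C * (Real.pi / 2), by positivity, fun z w => ?_⟩
  set x := Complex.arg w with hx
  set t := Complex.arg ((z / w : Circle) : ℂ) with ht
  have hxw : Circle.exp x = w := Circle.exp_arg w
  have hxz : Circle.exp (x + t) = z := by
    rw [Circle.exp_add, hxw, ht, Circle.exp_arg, mul_div_cancel]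
  have hx1 := Complex.neg_pi_lt_arg (w : ℂ)
  have hx2 := Complex.arg_le_pi (w : ℂ)
  have ht1 := Complex.neg_pi_lt_arg ((z / w : Circle) : ℂ)
  have ht2 := Complex.arg_le_pi ((z / w : Circle) : ℂ)
  have h1 := (convex_Icc (-(2 * Real.pi)) (2 * Real.pi)).norm_image_sub_le_of_norm_deriv_le
    (f := fun x => f (Circle.exp x)) (x := x) (y := x + t)
    (fun y _ => (hg.differentiable one_ne_zero) y) hC
    ⟨by linarith, by linarith⟩ ⟨by linarith, by linarith⟩
  simp only [hxw, hxz, add_sub_cancel_left, Real.norm_eq_abs] at h1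
  refine h1.trans ?_
  rw [mul_assoc]
  refine mul_le_mul_of_nonneg_left ?_ hC0
  have := abs_le_norm_exp_sub (x := x) (t := t) (abs_le.2 ⟨ht1.le, ht2⟩)
  rwa [hxz, hxw] at this

theorem measurable_truncKernel_right (ε : ℝ) (z : Circle) : Measurable (truncKernel ε z) :=
  (measurable_truncKernel ε).comp (measurable_const.prodMk measurable_id)

/-- The truncated kernel has Haar integral zero, so subtracting `f z` is free. It cancels the
first-order singularity when `f` is Lipschitz. -/
theorem truncHilbert_withDensity {f : Circle → ℝ} (hf : Continuous f) (hf0 : ∀ z, 0 ≤ f z)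
    {ε : ℝ} (hε : 0 < ε) (z : Circle) :
    truncHilbert (circleHaar.withDensity fun z => ENNReal.ofReal (f z)) ε z =
      ∫ w, truncKernel ε z w * (f w - f z) ∂circleHaar := by
  have hfm : Measurable f := hf.measurable
  obtain ⟨M, hM⟩ := (isCompact_univ (X := Circle)).exists_bound_of_continuousOn hf.continuousOn
  have hi : Integrable (truncKernel ε z) circleHaar :=
    Integrable.of_bound (measurable_truncKernel_right ε z).aestronglyMeasurable (2 / ε)
      (Filter.Eventually.of_forall fun w => abs_truncKernel_le hε z w)
  have hi2 : Integrable (fun w => truncKernel ε z w * f w) circleHaar :=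
    hi.mul_bdd (c := M) hfm.aestronglyMeasurable
      (Filter.Eventually.of_forall fun w => hM w (Set.mem_univ w))
  rw [truncHilbert_eq_integral, integral_withDensity_eq_integral_toReal_smul
    hfm.ennreal_ofReal (Filter.Eventually.of_forall fun _ => ENNReal.ofReal_lt_top)]
  simp_rw [mul_sub]
  rw [integral_sub hi2 (hi.mul_const _), integral_mul_const, integral_truncKernel_circleHaar,
    zero_mul, sub_zero]
  refine integral_congr_ae (Filter.Eventually.of_forall fun w => ?_)
  simp only [ENNReal.toReal_ofReal (hf0 w), smul_eq_mul, mul_comm]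

/-- The bound `C`, uniform in `ε` and `z`, is what later allows dominated convergence in `ε`. -/
theorem exists_hilbertTransform {μ : Measure Circle} (hμ : IsSmoothProbability μ) :
    ∃ (H : Circle → ℝ) (C : ℝ), IsHilbertTransform μ H ∧
      ∀ ε > 0, ∀ z, |truncHilbert μ ε z| ≤ C := by
  obtain ⟨hprob, f, hf, hf0, rfl⟩ := hμ
  obtain ⟨L, hL0, hL⟩ := exists_lipschitz_bound hf
  have hfm : Measurable f := hf.continuous.measurable
  have hbk : ∀ z w, |hilbertKernel z w * (f w - f z)| ≤ 2 * L := by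
    intro z w
    rw [abs_mul, abs_sub_comm]
    calc _ ≤ |hilbertKernel z w| * (L * ‖(z : ℂ) - (w : ℂ)‖) := by gcongr; exact hL z w
      _ = L * (|hilbertKernel z w| * ‖(z : ℂ) - (w : ℂ)‖) := by ring
      _ ≤ L * 2 := by gcongr; exact abs_hilbertKernel_mul_le z w
      _ = _ := by ring
  have hbound : ∀ ε z w, ‖truncKernel ε z w * (f w - f z)‖ ≤ 2 * L := by
    intro ε z w
    rw [truncKernel, Set.indicator_apply, Real.norm_eq_abs]
    split_ifs
    · exact hbk z w
    · rw [zero_mul, abs_zero]; positivity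
  refine ⟨fun z => ∫ w, hilbertKernel z w * (f w - f z) ∂circleHaar, 2 * L, fun z => ?_,
    fun ε hε z => ?_⟩
  · have : Filter.Tendsto (fun ε => ∫ w, truncKernel ε z w * (f w - f z) ∂circleHaar) (𝓝[>] 0)
        (𝓝 (∫ w, hilbertKernel z w * (f w - f z) ∂circleHaar)) := by
      refine tendsto_integral_filter_of_dominated_convergence (fun _ => 2 * L)
        (Filter.Eventually.of_forall fun ε =>
          ((measurable_truncKernel_right ε z).mul (hfm.sub_const _)).aestronglyMeasurable)
        (Filter.Eventually.of_forall fun ε => Filter.Eventually.of_forall (hbound ε z))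
        (integrable_const _) (Filter.Eventually.of_forall fun w => ?_)
      by_cases hw : w = z
      · simp [hw]
      refine tendsto_const_nhds.congr' ?_
      have hpos : 0 < ‖(z : ℂ) - (w : ℂ)‖ :=
        norm_pos_iff.2 (sub_ne_zero.2 fun e => hw (Circle.coe_injective e).symm)
      filter_upwards [nhdsWithin_le_nhds (Iio_mem_nhds hpos)] with ε hε
      rw [truncKernel, Set.indicator_of_mem (s := {w : Circle | ε < ‖(z : ℂ) - (w : ℂ)‖}) hε]
    refine this.congr' ?_
    filter_upwards [self_mem_nhdsWithin] with ε hε using (truncHilbert_withDensity hf.continuous hf0 hε z).symm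
  · rw [truncHilbert_withDensity hf.continuous hf0 hε z, ← Real.norm_eq_abs]
    refine (norm_integral_le_of_norm_le_const (Filter.Eventually.of_forall (hbound ε z))).trans ?_
    simp

theorem logNegPart_ne_top_of_isSmoothProbability {μ : Measure Circle}
    (hμ : IsSmoothProbability μ) : logNegPart μ ≠ ⊤ := by
  obtain ⟨hprob, f, hf, hf0, rfl⟩ := hμ
  obtain ⟨M, hM⟩ := (isCompact_univ (X := Circle)).exists_bound_of_continuousOn
    hf.continuous.continuousOn
  refine logNegPart_ne_top_of_le (C := ENNReal.ofReal M) ENNReal.ofReal_ne_top ?_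
  rw [← withDensity_const]
  refine withDensity_mono (Filter.Eventually.of_forall fun z => ENNReal.ofReal_le_ofReal ?_)
  exact (le_abs_self _).trans (hM z (Set.mem_univ z))

/-! ### Convexity of the kernel and of the potential -/

/-- First-order expansion below of a function whose second derivative is bounded below. -/
theorem add_deriv_mul_add_sq_le {q q' q'' : ℝ → ℝ} {c : ℝ} {D : Set ℝ} (hD : Convex ℝ D)
    (hq : ∀ x ∈ D, HasDerivAt q (q' x) x) (hq' : ∀ x ∈ D, HasDerivAt q' (q'' x) x)
    (hc : ∀ x ∈ D, c ≤ q'' x) {x y : ℝ} (hx : x ∈ D) (hy : y ∈ D) :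
    q x + q' x * (y - x) + c / 2 * (y - x) ^ 2 ≤ q y := by
  -- Subtracting the quadratic and the tangent at `x` leaves a convex function with zero derivative
  -- at `x`, hence minimal there.
  have hd : ∀ z ∈ D, HasDerivAt (fun z => q z - c / 2 * (z - x) ^ 2 - q' x * (z - x))
      (q' z - c * (z - x) - q' x) z := by
    intro z hz
    have h1 := (((hasDerivAt_id z).sub_const x).pow 2).const_mul (c / 2)
    have h2 := ((hasDerivAt_id z).sub_const x).const_mul (q' x)
    refine (((hq z hz).sub h1).sub h2).congr_deriv ?_
    simp only [id]
    ring
  have hd2 : ∀ z ∈ D, HasDerivAt (fun z => q' z - c * (z - x) - q' x) (q'' z - c) z := by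
    intro z hz
    have h1 := ((hasDerivAt_id z).sub_const x).const_mul c
    refine (((hq' z hz).sub h1).sub_const (q' x)).congr_deriv ?_
    ring
  have hconv : ConvexOn ℝ D (fun z => q z - c / 2 * (z - x) ^ 2 - q' x * (z - x)) := by
    refine convexOn_of_hasDerivWithinAt2_nonneg hD
      (fun z hz => (hd z hz).continuousAt.continuousWithinAt)
      (fun z hz => (hd z (interior_subset hz)).hasDerivWithinAt)
      (fun z hz => (hd2 z (interior_subset hz)).hasDerivWithinAt)
      (fun z hz => sub_nonneg.2 (hc z (interior_subset hz)))
  have h0 := hd x hx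
  rw [sub_self, mul_zero, sub_zero, sub_self] at h0
  rcases lt_trichotomy x y with hxy | rfl | hxy
  · have h := hconv.le_slope_of_hasDerivAt hx hy hxy h0
    rw [slope_def_field, le_div_iff₀ (sub_pos.2 hxy)] at h
    linarith
  · simp
  · have h := hconv.slope_le_of_hasDerivAt hy hx hxy h0
    rw [slope_def_field, div_le_iff₀ (sub_pos.2 hxy)] at h
    linarith

/-- The constant `1/8` is half of the lower bound `1/4` for the second derivative `1 / (4 sin²
(x/2))` of `-log sin (x/2)`. -/
theorem log_sin_half_le {u v : ℝ} (hu : u ∈ Set.Ioo 0 (2 * Real.pi))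
    (hv : v ∈ Set.Ioo 0 (2 * Real.pi)) :
    Real.log (Real.sin (v / 2)) ≤ Real.log (Real.sin (u / 2)) +
      Real.cot (u / 2) / 2 * (v - u) - (v - u) ^ 2 / 8 := by
  have hs : ∀ x ∈ Set.Ioo 0 (2 * Real.pi), 0 < Real.sin (x / 2) := fun x hx =>
    Real.sin_pos_of_pos_of_lt_pi (by linarith [hx.1]) (by linarith [hx.2])
  have hh : ∀ x : ℝ, HasDerivAt (fun x : ℝ => x / 2) (1 / 2) x := fun x =>
    (hasDerivAt_id x).div_const 2
  have h := add_deriv_mul_add_sq_le (D := Set.Ioo 0 (2 * Real.pi))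
    (q := fun x => -Real.log (Real.sin (x / 2)))
    (q' := fun x => -(Real.cos (x / 2) / Real.sin (x / 2) / 2))
    (q'' := fun x => 1 / (4 * Real.sin (x / 2) ^ 2)) (c := 1 / 4) (convex_Ioo _ _)
    (fun x hx => by
      have := (((hh x).sin).log (hs x hx).ne').neg
      refine this.congr_deriv ?_
      ring)
    (fun x hx => by
      have hne := (hs x hx).ne'
      have := ((((hh x).cos).div ((hh x).sin) hne).div_const 2).neg
      refine this.congr_deriv ?_
      have := Real.sin_sq_add_cos_sq (x / 2)
      field_simp
      nlinarith)
    (fun x hx => by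
      have h1 := hs x hx
      have h2 := Real.sin_le_one (x / 2)
      apply one_div_le_one_div_of_le (by positivity)
      nlinarith) hu hv
  rw [Real.cot_eq_cos_div_sin]
  nlinarith [h]

/-- Displacement convexity of the logarithmic kernel. -/
theorem log_norm_exp_sub_le {x y x' y' : ℝ} (hx : 0 < x - y) (hx2 : x - y < 2 * Real.pi)
    (hy : 0 < x' - y') (hy2 : x' - y' < 2 * Real.pi) :
    Real.log ‖(Circle.exp x' : ℂ) - (Circle.exp y' : ℂ)‖ ≤
      Real.log ‖(Circle.exp x : ℂ) - (Circle.exp y : ℂ)‖ +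
      hilbertKernel (Circle.exp x) (Circle.exp y) / 2 * ((x' - x) - (y' - y)) -
      ((x' - x) - (y' - y)) ^ 2 / 8 := by
  have hs : ∀ u, 0 < u → u < 2 * Real.pi → 0 < Real.sin (u / 2) := fun u h1 h2 =>
    Real.sin_pos_of_pos_of_lt_pi (by linarith) (by linarith)
  have h1 := hs _ hx hx2
  have h2 := hs _ hy hy2
  rw [Circle.norm_exp_sub_exp, Circle.norm_exp_sub_exp, hilbertKernel_exp, abs_of_pos h1,
    abs_of_pos h2, Real.log_mul two_ne_zero h1.ne', Real.log_mul two_ne_zero h2.ne']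
  have := log_sin_half_le ⟨hx, hx2⟩ ⟨hy, hy2⟩
  rw [show x' - y' - (x - y) = x' - x - (y' - y) by ring] at this
  linarith

theorem circleDeriv_exp (f : Circle → ℝ) (x : ℝ) :
    circleDeriv f (Circle.exp x) = deriv (fun x => f (Circle.exp x)) x := by
  rw [circleDeriv]
  simp_rw [← Circle.exp_add]
  rw [deriv_comp_const_add (fun x => f (Circle.exp x)), add_zero]

theorem potential_expansion {Q : Circle → ℝ} (hQ : ContMDiff (𝓡 1) 𝓘(ℝ, ℝ) 3 Q) {c : ℝ}
    (hconv : ∀ z, c ≤ circleDeriv (circleDeriv Q) z) (x y : ℝ) :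
    Q (Circle.exp x) + circleDeriv Q (Circle.exp x) * (y - x) + c / 2 * (y - x) ^ 2 ≤
      Q (Circle.exp y) := by
  have hq : ContDiff ℝ 3 fun x => Q (Circle.exp x) := contDiff_comp_circleExp (n := 3) hQ
  have hq1 : Differentiable ℝ fun x => Q (Circle.exp x) := hq.differentiable (by norm_num)
  have e1 : (fun x => circleDeriv Q (Circle.exp x)) = deriv fun x => Q (Circle.exp x) :=
    funext (circleDeriv_exp Q)
  have hq2 : Differentiable ℝ fun x => circleDeriv Q (Circle.exp x) := by
    rw [e1]
    exact (hq.of_le (by norm_num)).differentiable_deriv_two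
  refine add_deriv_mul_add_sq_le (D := Set.univ) convex_univ
    (q := fun x => Q (Circle.exp x)) (q' := fun x => circleDeriv Q (Circle.exp x))
    (q'' := fun x => circleDeriv (circleDeriv Q) (Circle.exp x))
    (fun x _ => ?_) (fun x _ => ?_) (fun x _ => hconv _) (Set.mem_univ _) (Set.mem_univ _)
  · rw [circleDeriv_exp]; exact (hq1 x).hasDerivAt
  · simp only [circleDeriv_exp (circleDeriv Q)]; exact (hq2 x).hasDerivAt

theorem continuous_circleDeriv {Q : Circle → ℝ} (hQ : ContMDiff (𝓡 1) 𝓘(ℝ, ℝ) 1 Q) :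
    Continuous (circleDeriv Q) := by
  have hq : ContDiff ℝ 1 fun x => Q (Circle.exp x) := contDiff_comp_circleExp (n := 1) hQ
  have hc : Continuous (circleDeriv Q ∘ Circle.exp) := by
    rw [show circleDeriv Q ∘ Circle.exp = deriv fun x => Q (Circle.exp x) from
      funext (circleDeriv_exp Q)]
    exact hq.continuous_deriv le_rfl
  exact (isLocalHomeomorph_circleExp.isOpenMap.isQuotientMap Circle.exp.continuous
    Circle.exp_surjective).continuous_iff.2 hc

/-! ### Displacement convexity of the logarithmic energy -/

/-- The cross term is the square of the mean of `θ` and vanishes. -/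
theorem integral_prod_sub_sq_div_eight {lam : Measure ℝ} [IsProbabilityMeasure lam] {θ : ℝ → ℝ}
    (hθi : Integrable θ lam) (hθsq : Integrable (fun s => θ s ^ 2) lam)
    (hmean : ∫ s, θ s ∂lam = 0) :
    ∫ p, (θ p.1 - θ p.2) ^ 2 / 8 ∂(lam.prod lam) = 1 / 4 * ∫ s, θ s ^ 2 ∂lam := by
  have e : ∀ p : ℝ × ℝ, (θ p.1 - θ p.2) ^ 2 / 8 =
      θ p.1 ^ 2 / 8 + θ p.2 ^ 2 / 8 - θ p.1 * θ p.2 / 4 := fun p => by ring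
  have i1 : Integrable (fun p : ℝ × ℝ => θ p.1 ^ 2 / 8) (lam.prod lam) :=
    (hθsq.comp_fst lam).div_const 8
  have i2 : Integrable (fun p : ℝ × ℝ => θ p.2 ^ 2 / 8) (lam.prod lam) :=
    (hθsq.comp_snd lam).div_const 8
  have i12 : Integrable (fun p : ℝ × ℝ => θ p.1 ^ 2 / 8 + θ p.2 ^ 2 / 8) (lam.prod lam) :=
    i1.add i2
  have i3 : Integrable (fun p : ℝ × ℝ => θ p.1 * θ p.2 / 4) (lam.prod lam) :=
    (hθi.mul_prod hθi).div_const 4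
  simp_rw [e]
  rw [integral_sub i12 i3, integral_add i1 i2, integral_div, integral_div,
    integral_div, integral_prod_mul (fun s => θ s) (fun s => θ s),
    integral_fun_fst (fun s => θ s ^ 2), integral_fun_snd (fun s => θ s ^ 2), hmean]
  simp
  ring

/-- Applied to `X` and `Y` with the same `t ≤ s`, this puts both differences in `(0, 2π)`, the
interval on which `log sin (u/2)` is concave. -/
theorem sub_mem_Ioo_of_exp_ne {Z : ℝ → ℝ} {c : ℝ} (hZ : Monotone Z)
    (hZm : ∀ s, Z s ∈ Set.Icc c (c + 2 * Real.pi)) {s t : ℝ} (hst : t ≤ s)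
    (hne : Circle.exp (Z s) ≠ Circle.exp (Z t)) : 0 < Z s - Z t ∧ Z s - Z t < 2 * Real.pi := by
  have h1 := hZ hst
  have h2 := hZm s
  have h3 := hZm t
  constructor
  · refine lt_of_le_of_ne (by linarith) fun h => hne ?_
    rw [show Z s = Z t by linarith]
  · refine lt_of_le_of_ne (by linarith [h2.2, h3.1]) fun h => hne ?_
    rw [show Z s = Z t + 2 * Real.pi by linarith, Circle.exp_add_two_pi]

set_option maxHeartbeats 1000000 in
/-- Displacement convexity of the logarithmic energy, along monotone lifts `X`, `Y` of `μ`, `ν` with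
mean-zero displacement. -/
theorem integral_log_norm_sub_le_of_lift {μ ν : Measure Circle} [IsProbabilityMeasure μ]
    [IsProbabilityMeasure ν] (hμ : logNegPart μ ≠ ⊤) (hν : logNegPart ν ≠ ⊤)
    {X Y : ℝ → ℝ} {a b : ℝ} (hX : Monotone X) (hY : Monotone Y)
    (hXm : ∀ s, X s ∈ Set.Icc a (a + 2 * Real.pi)) (hYm : ∀ s, Y s ∈ Set.Icc b (b + 2 * Real.pi))
    (hXmap : (volume.restrict (Set.Ioo 0 1)).map (fun s => Circle.exp (X s)) = μ)
    (hYmap : (volume.restrict (Set.Ioo 0 1)).map (fun s => Circle.exp (Y s)) = ν)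
    (hmean : ∫ s in Set.Ioo 0 1, (Y s - X s) = 0)
    {H : Circle → ℝ} {C : ℝ} (hH : IsHilbertTransform μ H)
    (hC : ∀ ε > 0, ∀ z, |truncHilbert μ ε z| ≤ C) :
    ∫ p : Circle × Circle, Real.log ‖(p.1 : ℂ) - (p.2 : ℂ)‖ ∂(ν.prod ν) ≤
      ∫ p : Circle × Circle, Real.log ‖(p.1 : ℂ) - (p.2 : ℂ)‖ ∂(μ.prod μ) +
      (∫ s in Set.Ioo 0 1, (Y s - X s) * H (Circle.exp (X s))) -
      1 / 4 * ∫ s in Set.Ioo 0 1, (Y s - X s) ^ 2 := by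
  set lam : Measure ℝ := volume.restrict (Set.Ioo 0 1) with hlam
  have hprob : IsProbabilityMeasure lam := ⟨by simp [hlam]⟩
  have hXe : Measurable fun s => Circle.exp (X s) := Circle.exp.continuous.measurable.comp hX.measurable
  have hYe : Measurable fun s => Circle.exp (Y s) := Circle.exp.continuous.measurable.comp hY.measurable
  set θ : ℝ → ℝ := fun s => Y s - X s with hθ
  have hθm : Measurable θ := hY.measurable.sub hX.measurable
  obtain ⟨B, hB⟩ : ∃ B, ∀ s, |θ s| ≤ B := by
    refine ⟨|b| + |a| + 2 * Real.pi, fun s => ?_⟩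
    have h1 := hXm s
    have h2 := hYm s
    rw [abs_le]
    constructor
    · linarith [h1.2, h2.1, neg_abs_le b, le_abs_self a]
    · linarith [h1.1, h2.2, neg_abs_le a, le_abs_self b]
  have hB0 : 0 ≤ B := (abs_nonneg _).trans (hB 0)
  let LX : ℝ × ℝ → ℝ := fun p =>
    Real.log ‖(Circle.exp (X p.1) : ℂ) - (Circle.exp (X p.2) : ℂ)‖
  let LY : ℝ × ℝ → ℝ := fun p =>
    Real.log ‖(Circle.exp (Y p.1) : ℂ) - (Circle.exp (Y p.2) : ℂ)‖
  -- The cutoff involves `X` only: the Hilbert kernel is evaluated along `X`, and all terms are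
  -- truncated on this one set.
  let S : ℝ → Set (ℝ × ℝ) := fun ε =>
    {p | ε < ‖(Circle.exp (X p.1) : ℂ) - (Circle.exp (X p.2) : ℂ)‖}
  let K : ℝ → ℝ × ℝ → ℝ := fun ε p => truncKernel ε (Circle.exp (X p.1)) (Circle.exp (X p.2))
  let D : ℝ × ℝ → ℝ := fun p => (θ p.1 - θ p.2) ^ 2 / 8
  have hXp : MeasurePreserving (fun s => Circle.exp (X s)) lam μ := ⟨hXe, hXmap⟩
  have hXX : MeasurePreserving (fun p : ℝ × ℝ => (Circle.exp (X p.1), Circle.exp (X p.2)))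
      (lam.prod lam) (μ.prod μ) :=
    hXp.prod hXp
  have hYp : MeasurePreserving (fun s => Circle.exp (Y s)) lam ν := ⟨hYe, hYmap⟩
  have hYY : MeasurePreserving (fun p : ℝ × ℝ => (Circle.exp (Y p.1), Circle.exp (Y p.2)))
      (lam.prod lam) (ν.prod ν) :=
    hYp.prod hYp
  have hLXi : Integrable LX (lam.prod lam) := hXX.integrable_comp_of_integrable
    (integrable_log_norm_sub hμ)
  have hLYi : Integrable LY (lam.prod lam) := hYY.integrable_comp_of_integrable
    (integrable_log_norm_sub hν)
  have hLX : ∫ p, LX p ∂(lam.prod lam) =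
      ∫ p : Circle × Circle, Real.log ‖(p.1 : ℂ) - (p.2 : ℂ)‖ ∂(μ.prod μ) := by
    rw [← hXX.map_eq, integral_map hXX.measurable.aemeasurable
      measurable_log_norm_sub.aestronglyMeasurable]
  have hLY : ∫ p, LY p ∂(lam.prod lam) =
      ∫ p : Circle × Circle, Real.log ‖(p.1 : ℂ) - (p.2 : ℂ)‖ ∂(ν.prod ν) := by
    rw [← hYY.map_eq, integral_map hYY.measurable.aemeasurable
      measurable_log_norm_sub.aestronglyMeasurable]
  have hSm : ∀ ε, MeasurableSet (S ε) := fun ε =>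
    measurableSet_lt measurable_const (Circle.measurable_norm_coe_sub.comp hXX.measurable)
  have hKm : ∀ ε, Measurable (K ε) := fun ε => (measurable_truncKernel ε).comp hXX.measurable
  have hθ1 : Measurable fun p : ℝ × ℝ => θ p.1 := hθm.comp measurable_fst
  have hθ2 : Measurable fun p : ℝ × ℝ => θ p.2 := hθm.comp measurable_snd
  have hDm : Measurable D := ((hθ1.sub hθ2).pow_const 2).div_const 8
  have hDb : ∀ p, ‖D p‖ ≤ (2 * B) ^ 2 / 8 := by
    intro p
    have h1 : |θ p.1 - θ p.2| ≤ 2 * B := (abs_sub _ _).trans (by linarith [hB p.1, hB p.2])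
    have h2 := pow_le_pow_left₀ (abs_nonneg _) h1 2
    rw [sq_abs] at h2
    rw [Real.norm_eq_abs, abs_of_nonneg (by simp only [D]; positivity)]
    simp only [D]
    linarith
  have hDi : Integrable D (lam.prod lam) := Integrable.of_bound hDm.aestronglyMeasurable _
    (Filter.Eventually.of_forall hDb)
  have hθi : Integrable θ lam := Integrable.of_bound hθm.aestronglyMeasurable B
    (Filter.Eventually.of_forall hB)
  have hθsq : Integrable (fun s => θ s ^ 2) lam :=
    Integrable.of_bound (hθm.pow_const 2).aestronglyMeasurable (B ^ 2)
      (Filter.Eventually.of_forall fun s => by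
        rw [Real.norm_eq_abs, abs_pow]; exact pow_le_pow_left₀ (abs_nonneg _) (hB s) 2)
  have hDint : ∫ p, D p ∂(lam.prod lam) = 1 / 4 * ∫ s, θ s ^ 2 ∂lam :=
    integral_prod_sub_sq_div_eight hθi hθsq hmean
  have hne : ∀ᵐ p ∂(lam.prod lam), Circle.exp (Y p.1) ≠ Circle.exp (Y p.2) :=
    hYY.quasiMeasurePreserving.ae (ae_ne_of_logNegPart_ne_top hν)
  have hneX : ∀ᵐ p ∂(lam.prod lam), Circle.exp (X p.1) ≠ Circle.exp (X p.2) :=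
    hXX.quasiMeasurePreserving.ae (ae_ne_of_logNegPart_ne_top hμ)
  have hpt : ∀ ε > 0, ∀ p : ℝ × ℝ, Circle.exp (Y p.1) ≠ Circle.exp (Y p.2) →
      (S ε).indicator LY p ≤ (S ε).indicator LX p + K ε p / 2 * (θ p.1 - θ p.2) -
        (S ε).indicator D p := by
    rintro ε hε ⟨s, t⟩ hpY
    have hK : K ε (s, t) = (S ε).indicator
        (fun p => hilbertKernel (Circle.exp (X p.1)) (Circle.exp (X p.2))) (s, t) := by
      simp only [K, S, truncKernel, Set.indicator_apply, Set.mem_ofPred_eq]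
    by_cases hp : (s, t) ∈ S ε
    swap
    · rw [hK]; simp [hp]
    rw [hK, Set.indicator_of_mem hp, Set.indicator_of_mem hp, Set.indicator_of_mem hp,
      Set.indicator_of_mem hp]
    have hpX : Circle.exp (X s) ≠ Circle.exp (X t) := by
      intro h
      have : ε < ‖(Circle.exp (X s) : ℂ) - (Circle.exp (X t) : ℂ)‖ := hp
      rw [h, sub_self, norm_zero] at this
      linarith
    simp only [LX, LY, D, hθ]
    rcases le_total t s with hts | hst
    · obtain ⟨x1, x2⟩ := sub_mem_Ioo_of_exp_ne hX hXm hts hpX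
      obtain ⟨y1, y2⟩ := sub_mem_Ioo_of_exp_ne hY hYm hts hpY
      exact log_norm_exp_sub_le x1 x2 y1 y2
    · obtain ⟨x1, x2⟩ := sub_mem_Ioo_of_exp_ne hX hXm hst hpX.symm
      obtain ⟨y1, y2⟩ := sub_mem_Ioo_of_exp_ne hY hYm hst hpY.symm
      have := log_norm_exp_sub_le x1 x2 y1 y2
      rw [norm_sub_rev, norm_sub_rev (Circle.exp (X t) : ℂ), hilbertKernel_swap] at this
      linarith
  have hKi : ∀ ε > 0, ∀ g : ℝ × ℝ → ℝ, Measurable g → (∀ p, |g p| ≤ B) →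
      Integrable (fun p => K ε p * g p) (lam.prod lam) := by
    intro ε hε g hg hgB
    refine Integrable.of_bound ((hKm ε).mul hg).aestronglyMeasurable (2 / ε * B)
      (Filter.Eventually.of_forall fun p => ?_)
    rw [norm_mul]
    exact mul_le_mul (abs_truncKernel_le hε _ _) (hgB p) (abs_nonneg _) (by positivity)
  -- Antisymmetry of the kernel makes the two halves of `θ p.1 - θ p.2` contribute equally, which
  -- absorbs the factor `1/2`.
  have hKθ : ∀ ε > 0, ∫ p, K ε p / 2 * (θ p.1 - θ p.2) ∂(lam.prod lam) =
      ∫ s, θ s * truncHilbert μ ε (Circle.exp (X s)) ∂lam := by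
    intro ε hε
    have i1 := hKi ε hε _ hθ1 fun p => hB p.1
    have i2 := hKi ε hε _ hθ2 fun p => hB p.2
    have hsw : ∫ p, K ε p * θ p.2 ∂(lam.prod lam) = -∫ p, K ε p * θ p.1 ∂(lam.prod lam) := by
      rw [← integral_prod_swap, ← integral_neg]
      refine integral_congr_ae (Filter.Eventually.of_forall fun p => ?_)
      simp only [K, Prod.fst_swap, Prod.snd_swap]
      rw [truncKernel_swap]
      ring
    have e : ∀ p : ℝ × ℝ, K ε p / 2 * (θ p.1 - θ p.2) =
        1 / 2 * (K ε p * θ p.1 - K ε p * θ p.2) := fun p => by ring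
    simp_rw [e]
    rw [integral_const_mul, integral_sub i1 i2, hsw, integral_prod _ i1]
    have hT : ∀ s, truncHilbert μ ε (Circle.exp (X s)) = ∫ t, K ε (s, t) ∂lam := by
      intro s
      rw [truncHilbert_eq_integral, ← hXmap, integral_map hXe.aemeasurable
        (measurable_truncKernel_right ε _).aestronglyMeasurable]
    simp_rw [hT, integral_mul_const, mul_comm (θ _)]
    ring
  have hineq : ∀ ε > 0, ∫ p, (S ε).indicator LY p ∂(lam.prod lam) ≤
      ∫ p, (S ε).indicator LX p ∂(lam.prod lam) +
        ∫ s, θ s * truncHilbert μ ε (Circle.exp (X s)) ∂lam -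
        ∫ p, (S ε).indicator D p ∂(lam.prod lam) := by
    intro ε hε
    have i1 := hLYi.indicator (hSm ε)
    have i2 := hLXi.indicator (hSm ε)
    have i3 := hDi.indicator (hSm ε)
    have i4 : Integrable (fun p => K ε p / 2 * (θ p.1 - θ p.2)) (lam.prod lam) := by
      refine (((hKi ε hε _ hθ1 fun p => hB p.1).sub (hKi ε hε _ hθ2 fun p => hB p.2)).const_mul
        (1 / 2)).congr (Filter.Eventually.of_forall fun p => ?_)
      simp only [Pi.sub_apply]
      ring
    have i5 : Integrable (fun p => (S ε).indicator LX p + K ε p / 2 * (θ p.1 - θ p.2))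
        (lam.prod lam) := i2.add i4
    rw [← hKθ ε hε, ← integral_add i2 i4, ← integral_sub i5 i3]
    refine integral_mono_ae i1 (i5.sub i3) ?_
    filter_upwards [hne] with p hp using hpt ε hε p hp
  -- As `ε` tends to zero the sets `S ε` exhaust almost every pair, since `μ` does not charge the
  -- diagonal.
  have hlim : ∀ {g : ℝ × ℝ → ℝ}, Integrable g (lam.prod lam) →
      Filter.Tendsto (fun ε => ∫ p, (S ε).indicator g p ∂(lam.prod lam)) (𝓝[>] 0)
        (𝓝 (∫ p, g p ∂(lam.prod lam))) := by
    intro g hg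
    refine tendsto_integral_filter_of_dominated_convergence (fun p => ‖g p‖)
      (Filter.Eventually.of_forall fun ε => (hg.indicator (hSm ε)).aestronglyMeasurable)
      (Filter.Eventually.of_forall fun ε => Filter.Eventually.of_forall fun p =>
        norm_indicator_le_norm_self _ _) hg.norm ?_
    filter_upwards [hneX] with p hp
    refine tendsto_const_nhds.congr' ?_
    have hpos : 0 < ‖(Circle.exp (X p.1) : ℂ) - (Circle.exp (X p.2) : ℂ)‖ :=
      norm_pos_iff.2 (sub_ne_zero.2 fun e => hp (Circle.coe_injective e))
    filter_upwards [nhdsWithin_le_nhds (Iio_mem_nhds hpos)] with ε hε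
    rw [Set.indicator_of_mem (s := S ε) hε]
  have hlimT : Filter.Tendsto (fun ε => ∫ s, θ s * truncHilbert μ ε (Circle.exp (X s)) ∂lam)
      (𝓝[>] 0) (𝓝 (∫ s, θ s * H (Circle.exp (X s)) ∂lam)) := by
    refine tendsto_integral_filter_of_dominated_convergence (fun _ => B * C)
      (Filter.Eventually.of_forall fun ε =>
        (hθm.mul ((measurable_truncHilbert μ ε).comp hXe)).aestronglyMeasurable) ?_
      (integrable_const _) (Filter.Eventually.of_forall fun s => (hH _).const_mul _)
    filter_upwards [self_mem_nhdsWithin] with ε hε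
    refine Filter.Eventually.of_forall fun s => ?_
    rw [norm_mul]
    exact mul_le_mul (hB s) (hC ε hε _) (abs_nonneg _) hB0
  rw [← hLX, ← hLY, ← hDint]
  refine le_of_tendsto_of_tendsto (hlim hLYi) (((hlim hLXi).add hlimT).sub (hlim hDi)) ?_
  filter_upwards [self_mem_nhdsWithin] with ε hε using hineq ε hε

/-! ### Mean of the Hilbert transform and the log-Sobolev inequality -/

theorem IsHilbertTransform.measurable {μ : Measure Circle} [IsProbabilityMeasure μ]
    {H : Circle → ℝ} (hH : IsHilbertTransform μ H) : Measurable H :=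
  measurable_of_tendsto_metrizable' (𝓝[>] 0) (fun ε => measurable_truncHilbert μ ε)
    (tendsto_pi_nhds.2 hH)

theorem IsHilbertTransform.abs_le {μ : Measure Circle} {H : Circle → ℝ} {C : ℝ}
    (hH : IsHilbertTransform μ H) (hC : ∀ ε > 0, ∀ z, |truncHilbert μ ε z| ≤ C) (z : Circle) :
    |H z| ≤ C := by
  refine le_of_tendsto (hH z).abs ?_
  filter_upwards [self_mem_nhdsWithin] with ε hε using hC ε hε z

/-- Truncation keeps the kernel antisymmetric and makes it bounded, so Fubini applies and the double
integral equals its own negative. -/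
theorem integral_truncHilbert_self (μ : Measure Circle) [IsProbabilityMeasure μ] {ε : ℝ}
    (hε : 0 < ε) : ∫ z, truncHilbert μ ε z ∂μ = 0 := by
  have hi : Integrable (fun p : Circle × Circle => truncKernel ε p.1 p.2) (μ.prod μ) :=
    Integrable.of_bound (measurable_truncKernel ε).aestronglyMeasurable (2 / ε)
      (Filter.Eventually.of_forall fun p => abs_truncKernel_le hε _ _)
  simp_rw [truncHilbert_eq_integral]
  rw [← integral_prod _ hi]
  have h : ∫ p : Circle × Circle, truncKernel ε p.1 p.2 ∂(μ.prod μ) =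
      -∫ p : Circle × Circle, truncKernel ε p.1 p.2 ∂(μ.prod μ) := by
    conv_lhs => rw [← integral_prod_swap]
    rw [← integral_neg]
    exact integral_congr_ae (Filter.Eventually.of_forall fun p => truncKernel_swap _ _ _)
  linarith

theorem IsHilbertTransform.integral_eq_zero {μ : Measure Circle} [IsProbabilityMeasure μ]
    {H : Circle → ℝ} {C : ℝ} (hH : IsHilbertTransform μ H)
    (hC : ∀ ε > 0, ∀ z, |truncHilbert μ ε z| ≤ C) : ∫ z, H z ∂μ = 0 := by
  have h : Filter.Tendsto (fun ε => ∫ z, truncHilbert μ ε z ∂μ) (𝓝[>] 0) (𝓝 (∫ z, H z ∂μ)) := by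
    refine tendsto_integral_filter_of_dominated_convergence (fun _ => C)
      (Filter.Eventually.of_forall fun ε => (measurable_truncHilbert μ ε).aestronglyMeasurable) ?_
      (integrable_const _) (Filter.Eventually.of_forall hH)
    filter_upwards [self_mem_nhdsWithin] with ε hε
    exact Filter.Eventually.of_forall (hC ε hε)
  refine tendsto_nhds_unique h (tendsto_const_nhds.congr' ?_)
  filter_upwards [self_mem_nhdsWithin] with ε hε using (integral_truncHilbert_self μ hε).symm

/-- The transport inequality between the energies of `μ` and `ν` behind the free log-Sobolev
inequality. -/
theorem energy_sub_le_freeFisher {Q : Circle → ℝ} (hQ : ContMDiff (𝓡 1) 𝓘(ℝ, ℝ) 3 Q) {ρ : ℝ}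
    (hρ : 0 < ρ) (hconv : ∀ z : Circle, ρ - 1 / 2 ≤ circleDeriv (circleDeriv Q) z)
    {μ ν : Measure Circle} [IsProbabilityMeasure μ] [IsProbabilityMeasure ν]
    (hμ : logNegPart μ ≠ ⊤) (hν : logNegPart ν ≠ ⊤)
    {H : Circle → ℝ} {C : ℝ} (hH : IsHilbertTransform μ H)
    (hC : ∀ ε > 0, ∀ z, |truncHilbert μ ε z| ≤ C) :
    Integrable (fun z => (H z - circleDeriv Q z) ^ 2) μ ∧
    (∫ z, Q z ∂μ - ∫ p : Circle × Circle, Real.log ‖(p.1 : ℂ) - (p.2 : ℂ)‖ ∂(μ.prod μ)) -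
      (∫ z, Q z ∂ν - ∫ p : Circle × Circle, Real.log ‖(p.1 : ℂ) - (p.2 : ℂ)‖ ∂(ν.prod ν)) ≤
      1 / (2 * ρ) * freeFisher Q μ H := by
  have hHm := hH.measurable
  have hHb := hH.abs_le hC
  have hQc : Continuous Q := hQ.continuous
  have hQ'c : Continuous (circleDeriv Q) := continuous_circleDeriv (hQ.of_le (by norm_num))
  have hQ'm : Measurable (circleDeriv Q) := hQ'c.measurable
  obtain ⟨M, hM⟩ := (isCompact_univ (X := Circle)).exists_bound_of_continuousOn hQc.continuousOn
  obtain ⟨M', hM'⟩ := (isCompact_univ (X := Circle)).exists_bound_of_continuousOn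
    hQ'c.continuousOn
  have hHi : Integrable H μ := Integrable.of_bound hHm.aestronglyMeasurable C
    (Filter.Eventually.of_forall hHb)
  have hQ'i : Integrable (circleDeriv Q) μ := Integrable.of_bound hQ'm.aestronglyMeasurable M'
    (Filter.Eventually.of_forall fun z => hM' z (Set.mem_univ z))
  have hFb : ∀ z, |H z - circleDeriv Q z| ≤ C + M' := fun z =>
    (abs_sub _ _).trans (add_le_add (hHb z) (hM' z (Set.mem_univ z)))
  have hFi : Integrable (fun z => (H z - circleDeriv Q z) ^ 2) μ := by
    refine Integrable.of_bound ((hHm.sub hQ'm).pow_const 2).aestronglyMeasurable ((C + M') ^ 2)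
      (Filter.Eventually.of_forall fun z => ?_)
    rw [norm_pow]
    exact pow_le_pow_left₀ (abs_nonneg _) (hFb z) 2
  refine ⟨hFi, ?_⟩
  obtain ⟨a, X, hX, hXm, hXmap, hX0⟩ := exists_monotone_lift μ (measure_singleton_eq_zero hμ) 0
  obtain ⟨b, Y, hY, hYm, hYmap, hY0⟩ := exists_monotone_lift ν (measure_singleton_eq_zero hν) 0
  set lam : Measure ℝ := volume.restrict (Set.Ioo 0 1) with hlam
  have hprob : IsProbabilityMeasure lam := ⟨by simp [hlam]⟩
  have hXe : Measurable fun s => Circle.exp (X s) :=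
    Circle.exp.continuous.measurable.comp hX.measurable
  have hYe : Measurable fun s => Circle.exp (Y s) :=
    Circle.exp.continuous.measurable.comp hY.measurable
  have hIcc : ∀ {Z : ℝ → ℝ} {c : ℝ}, Monotone Z → (∀ s, Z s ∈ Set.Icc c (c + 2 * Real.pi)) →
      ∀ {μ' : Measure ℝ}, IsProbabilityMeasure μ' → MemLp Z 2 μ' := fun {Z c} hZ hZm {μ'} _ =>
    MemLp.of_bound hZ.measurable.aestronglyMeasurable (max |c| |c + 2 * Real.pi|)
      (Filter.Eventually.of_forall fun s => abs_le_max_abs_abs (hZm s).1 (hZm s).2)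
  have hX2 : MemLp X 2 lam := hIcc hX hXm hprob
  have hY2 : MemLp Y 2 lam := hIcc hY hYm hprob
  have hθ2 : MemLp (fun s => Y s - X s) 2 lam := hY2.sub hX2
  have hθi : Integrable (fun s => Y s - X s) lam := hθ2.integrable one_le_two
  have hθsq : Integrable (fun s => (Y s - X s) ^ 2) lam := hθ2.integrable_sq
  have hmean : ∫ s, (Y s - X s) ∂lam = 0 := by
    rw [integral_sub (hY2.integrable one_le_two) (hX2.integrable one_le_two), hX0, hY0, sub_zero]
  have hlog := integral_log_norm_sub_le_of_lift hμ hν hX hY hXm hYm hXmap hYmap hmean hH hC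
  rw [← hlam] at hlog
  have hQX : ∫ z, Q z ∂μ = ∫ s, Q (Circle.exp (X s)) ∂lam := by
    rw [← hXmap, integral_map hXe.aemeasurable hQc.measurable.aestronglyMeasurable]
  have hQY : ∫ z, Q z ∂ν = ∫ s, Q (Circle.exp (Y s)) ∂lam := by
    rw [← hYmap, integral_map hYe.aemeasurable hQc.measurable.aestronglyMeasurable]
  have iQX : Integrable (fun s => Q (Circle.exp (X s))) lam :=
    Integrable.of_bound (hQc.measurable.comp hXe).aestronglyMeasurable M
      (Filter.Eventually.of_forall fun s => hM _ (Set.mem_univ _))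
  have iQY : Integrable (fun s => Q (Circle.exp (Y s))) lam :=
    Integrable.of_bound (hQc.measurable.comp hYe).aestronglyMeasurable M
      (Filter.Eventually.of_forall fun s => hM _ (Set.mem_univ _))
  have iH : Integrable (fun s => (Y s - X s) * H (Circle.exp (X s))) lam :=
    hθi.mul_bdd (c := C) (hHm.comp hXe).aestronglyMeasurable
      (Filter.Eventually.of_forall fun s => hHb _)
  -- The linear term contains only `∫ Q'`, because `H` has `μ`-mean zero.
  have hFint : ∀ c, ∫ z, (H z - circleDeriv Q z + c) ^ 2 ∂μ =
      ∫ z, (H z - circleDeriv Q z) ^ 2 ∂μ - 2 * c * ∫ z, circleDeriv Q z ∂μ + c ^ 2 := by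
    intro c
    have e : ∀ z, (H z - circleDeriv Q z + c) ^ 2 =
        (H z - circleDeriv Q z) ^ 2 + 2 * c * (H z - circleDeriv Q z) + c ^ 2 := fun z => by ring
    have i2 : Integrable (fun z => 2 * c * (H z - circleDeriv Q z)) μ :=
      (hHi.sub hQ'i).const_mul _
    have i3 : Integrable (fun z => (H z - circleDeriv Q z) ^ 2 +
      2 * c * (H z - circleDeriv Q z)) μ := hFi.add i2
    simp_rw [e]
    rw [integral_add i3 (integrable_const _), integral_add hFi i2, integral_const_mul,
      integral_sub hHi hQ'i, hH.integral_eq_zero hC]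
    simp
    ring
  -- This value minimizes the quadratic in `hFint`; the minimum is the free Fisher information.
  set c := ∫ z, circleDeriv Q z ∂μ with hc
  have hFm : Measurable fun z => (H z - circleDeriv Q z + c) ^ 2 :=
    ((hHm.sub hQ'm).add_const c).pow_const 2
  have hFX : ∫ s, (H (Circle.exp (X s)) - circleDeriv Q (Circle.exp (X s)) + c) ^ 2 ∂lam =
      freeFisher Q μ H := by
    have h1 := hFint c
    rw [← hXmap, integral_map hXe.aemeasurable hFm.aestronglyMeasurable, hXmap] at h1
    rw [h1, freeFisher]
    ring
  have iFX : Integrable (fun s => (H (Circle.exp (X s)) - circleDeriv Q (Circle.exp (X s)) + c) ^ 2)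
      lam := by
    refine Integrable.of_bound (hFm.comp hXe).aestronglyMeasurable ((C + M' + |c|) ^ 2)
      (Filter.Eventually.of_forall fun s => ?_)
    rw [norm_pow]
    exact pow_le_pow_left₀ (abs_nonneg _) ((abs_add_le _ _).trans (by gcongr; exact hFb _)) 2
  -- The quadratic coefficients combine as `1/4 + (ρ - 1/2)/2 = ρ/2`, and the square is completed in
  -- `t = Y s - X s`. The added term `c * (Y s - X s)` integrates to zero.
  have hpt : ∀ s, Q (Circle.exp (X s)) + (Y s - X s) * H (Circle.exp (X s)) -
      1 / 4 * (Y s - X s) ^ 2 + c * (Y s - X s) ≤ Q (Circle.exp (Y s)) +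
      1 / (2 * ρ) * (H (Circle.exp (X s)) - circleDeriv Q (Circle.exp (X s)) + c) ^ 2 := by
    intro s
    have h1 := potential_expansion hQ hconv (X s) (Y s)
    generalize H (Circle.exp (X s)) = h at *
    generalize circleDeriv Q (Circle.exp (X s)) = q at *
    generalize Y s - X s = t at *
    have h2 : (h - q + c) * t - ρ / 2 * t ^ 2 ≤ 1 / (2 * ρ) * (h - q + c) ^ 2 := by
      have h3 : 1 / (2 * ρ) * (h - q + c) ^ 2 - ((h - q + c) * t - ρ / 2 * t ^ 2) =
          1 / (2 * ρ) * (h - q + c - ρ * t) ^ 2 := by field_simp; ring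
      have h4 : 0 ≤ 1 / (2 * ρ) * (h - q + c - ρ * t) ^ 2 := by positivity
      linarith
    nlinarith
  have j1 : Integrable (fun s => Q (Circle.exp (X s)) + (Y s - X s) * H (Circle.exp (X s))) lam :=
    iQX.add iH
  have j2 : Integrable (fun s => Q (Circle.exp (X s)) + (Y s - X s) * H (Circle.exp (X s)) -
      1 / 4 * (Y s - X s) ^ 2) lam := j1.sub (hθsq.const_mul _)
  have hint := integral_mono (j2.add (hθi.const_mul c)) (iQY.add (iFX.const_mul (1 / (2 * ρ)))) hpt
  simp only [Pi.add_apply] at hint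
  rw [integral_add j2 (hθi.const_mul c), integral_sub j1 (hθsq.const_mul _), integral_add iQX iH,
    integral_add iQY (iFX.const_mul _), integral_const_mul, integral_const_mul,
    integral_const_mul, hmean, hFX, ← hQX, ← hQY] at hint
  linarith

theorem theoremt (Q : Circle → ℝ) (hQ : ContMDiff (𝓡 1) 𝓘(ℝ, ℝ) 3 Q) (ρ : ℝ) (hρ : 0 < ρ)
    (hconv : ∀ z : Circle, ρ - 1 / 2 ≤ circleDeriv (circleDeriv Q) z) :
    FreeLogSobolev Q (ρ / 2) := by
  obtain ⟨ν, hν, hνfin⟩ := exists_isEquilibriumMeasure hQ.continuous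
  have hνprob := hν.1
  refine ⟨half_pos hρ, ν, hν, ?_, ?_, fun μ hμ => ?_⟩
  · rw [logEnergy_eq_coe Q hνfin]; exact EReal.coe_ne_top _
  · rw [logEnergy_eq_coe Q hνfin]; exact EReal.coe_ne_bot _
  have hμprob := hμ.1
  have hμfin := logNegPart_ne_top_of_isSmoothProbability hμ
  obtain ⟨H, C, hH, hC⟩ := exists_hilbertTransform hμ
  obtain ⟨hi, hle⟩ := energy_sub_le_freeFisher hQ hρ hconv hμfin hνfin hH hC
  refine ⟨?_, H, hH, hi, ?_⟩
  · rw [logEnergy_eq_coe Q hμfin]; exact EReal.coe_ne_top _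
  · rw [logEnergy_eq_coe Q hμfin, logEnergy_eq_coe Q hνfin, ← EReal.coe_sub, EReal.coe_le_coe_iff,
      show 4 * (ρ / 2) = 2 * ρ by ring]
    exact hle
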